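/- **Setting.** Let $k$ be a field; all vector spaces, coalgebras (coassociative, counital) and comodules are over $k$. $CoCoalg_k$ is the symmetric monoidal category of cocommutative coalgebras (with $\otimes_k$). $Comod_k$ is the symmetric monoidal category of pairs $(C,D)$, where $C$ is a cocommutative coalgebra and $D$ is a (left) $C$-comodule, $y\mapsto y_{(0)}\otimes y_{(1)}\in C\otimes D$; a morphism $(C,D)\to(C',D')$ is a coalgebra map $f:C\to C'$ together with a map $g:D\to D'$ of $C'$-comodules, where $D$ is a $C'$-comodule by corestriction along $f$; and $(C,D)\otimes(C',D')=(C\otimes C',D\otimes D')$. **Operads.** A non-$\Sigma$ operad with multiplication $(\mathscr O,m,e)$ consists of vector spaces $\mathscr O(n)$, $n\ge 0$, bilinear operations $\circ_i:\mathscr O(p)\times\mathscr O(q)\to\mathscr O(p+q-1)$ for $i\geq 1$ (zero if $i>p$, in particular if $p=0$), and elements $\mathbb 1\in\mathscr O(1)$, $m\in\mathscr O(2)$, $e\in\mathscr O(0)$ such that for $u\in\mathscr O(p)$, $v\in\mathscr O(q)$, $w\in\mathscr O(r)$ $$(u\circ_iv)\circ_jw=\begin{cases}(u\circ_jw)\circ_{i+r-1}v&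 j<i\\ u\circ_i(v\circ_{j-i+1}w)& i\le j<q+i\\ (u\circ_{j-q+1}w)\circ_iv& j\ge q+i,\end{cases}$$ $u\circ_i\mathbb 1=u$ for $1\le i\le p$, $\mathbb 1\circ_1u=u$, $m\circ_1m=m\circ_2m$ and $m\circ_1e=m\circ_2e=\mathbb 1$. A cyclic unital comp module $\mathscr L$ over $(\mathscr O,m,e)$ consists of vector spaces $\mathscr L(n)$, $n\ge0$, bilinear operations $\bullet_i:\mathscr O(p)\times\mathscr L(n)\to\mathscr L(n-p+1)$ for $p\le n+1$ and $0\le i\le n+1-p$, and linear operators $t:\mathscr L(n)\to\mathscr L(n)$ for $n\ge1$, such that for $u\in\mathscr O(p)$, $v\in\mathscr O(q)$, $l\in\mathscr L(n)$ $$u\bullet_i(v\bullet_jl)=\begin{cases}v\bullet_j(u\bullet_{i+q-1}l)& j<i\\ (u\circ_{j-i+1}v)\bullet_il& j-p<i\le j\\ v\bullet_{j-p+1}(u\bullet_il)& 0\le i\le j-p\end{cases}$$ whenever the left-hand side is defined, $\mathbb 1\bullet_il=l$ for $0\le i\le n$, and, for $n\ge 1$, $t(u\bullet_il)=u\bullet_{i+1}t(l)$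 for $0\le i\le n-p$, and $t^{n+1}=\mathrm{id}$ on $\mathscr L(n)$. **Measurings.** Let $C$ be a cocommutative coalgebra. A $C$-measuring from $(\mathscr O,m,e)$ to $(\mathscr O',m',e')$ is a family of linear maps $\Psi_n:C\to \mathrm{Hom}_k(\mathscr O(n),\mathscr O'(n))$, $n\ge 0$, with $\Psi_{p+q-1}(x)(u\circ_iv)=\sum\Psi_p(x_{(1)})(u)\circ'_i\Psi_q(x_{(2)})(v)$, $\Psi_2(x)(m)=\epsilon_C(x)m'$ and $\Psi_0(x)(e)=\epsilon_C(x)e'$. Given such $\Psi$ and cyclic unital comp modules $\mathscr L,\mathscr L'$ over $\mathscr O,\mathscr O'$, a $(C,\Psi)$-comodule measuring from $\mathscr L$ to $\mathscr L'$ is a $C$-comodule $D$ with linear maps $\Omega_n:D\to\mathrm{Hom}_k(\mathscr L(n),\mathscr L'(n))$, $n\geq 0$, such that $\Omega_{n-p+1}(y)(u\bullet_il)=\sum\Psi_p(y_{(0)})(u)\bullet_i\Omega_n(y_{(1)})(l)$ for $0\le i\le n+1-p$, and $\Omega_n(y)(t(l))=t'(\Omega_n(y)(l))$ for $n\ge1$.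 **Theorem.** 1. For all non-$\Sigma$ operads with multiplication $\mathscr O,\mathscr O'$ there are a cocommutative coalgebra $\mathcal M_c(\mathscr O,\mathscr O')$ and an $\mathcal M_c(\mathscr O,\mathscr O')$-measuring $\Phi$ from $\mathscr O$ to $\mathscr O'$ such that for every cocommutative coalgebra $C$ and every $C$-measuring $\Psi$ from $\mathscr O$ to $\mathscr O'$ there is a unique coalgebra map $\xi:C\to\mathcal M_c(\mathscr O,\mathscr O')$ with $\Phi_n\circ\xi=\Psi_n$ for all $n\ge0$. 2. For every $C$-measuring $\Psi$ from $\mathscr O$ to $\mathscr O'$ and all cyclic unital comp modules $\mathscr L$ over $\mathscr O$ and $\mathscr L'$ over $\mathscr O'$ there is a $(C,\Psi)$-comodule measuring $(\mathcal Q_C(\mathscr L,\mathscr L'),\Theta)$ such that for every $(C,\Psi)$-comodule measuring $(D,\Omega)$ from $\mathscr L$ to $\mathscr L'$ there is a unique map of $C$-comodules $\chi:D\to\mathcal Q_C(\mathscr L,\mathscr L')$ with $\Theta_n\circ\chi=\Omega_n$ for all $n\ge0$. 3. For any choice of the universal measurings in 1, the non-$\Sigma$ operads with multiplication, with hom-objects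 $\mathcal M_c(\mathscr O,\mathscr O')$, form a category enriched over $CoCoalg_k$; its structure is the unique one whose identities $k\to \mathcal M_c(\mathscr O,\mathscr O)$ and compositions $\mathcal M_c(\mathscr O,\mathscr O')\otimes\mathcal M_c(\mathscr O',\mathscr O'')\to\mathcal M_c(\mathscr O,\mathscr O'')$ correspond, under the measurings $\Phi$, to the scalar multiples of the identity maps and to the composition of linear maps. 4. For any choice of the universal measurings in 1 and, for $C=\mathcal M_c(\mathscr O,\mathscr O')$ and $\Psi=\Phi$, of those in 2, the pairs $(\mathscr O,\mathscr L)$ of a non-$\Sigma$ operad with multiplication and a cyclic unital comp module over it, with hom-objects $(\mathcal M_c(\mathscr O,\mathscr O'),\mathcal Q_{\mathcal M_c(\mathscr O,\mathscr O')}(\mathscr L,\mathscr L'))$, form a category enriched over $Comod_k$; its structure is the unique one which on the coalgebra components is that of 3, and whose identities and compositions on the comodule components correspond, under the measurings $\Theta$, to the scalar multiples of the identity maps and to the composition of linear maps. -/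

import Mathlib

open CategoryTheory MonoidalCategory
open scoped TensorProduct

universe u

noncomputable section

namespace Measuring

/-! ### The symmetric monoidal category of cocommutative coalgebras -/

/-- A cocommutative (coassociative, counital) `k`-coalgebra. -/
structure CoCoalg (k : Type u) [Field k] : Type (u + 1) where
  carrier : Type u
  [addCommGroup : AddCommGroup carrier]
  [module : Module k carrier]
  [coalgebra : Coalgebra k carrier]
  [isCocomm : Coalgebra.IsCocomm k carrier]

attribute [instance] CoCoalg.addCommGroup CoCoalg.module CoCoalg.coalgebra CoCoalg.isCocomm

namespace CoCoalg

variable {k : Type u} [Field k]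

instance : CoeSort (CoCoalg k) (Type u) := ⟨CoCoalg.carrier⟩

instance : Category (CoCoalg k) where
  Hom C D := C →ₗc[k] D
  id C := CoalgHom.id k C
  comp f g := CoalgHom.comp g f

/-- The coalgebra map underlying a morphism. -/
abbrev Hom.toCoalgHom {C D : CoCoalg k} (f : C ⟶ D) : C →ₗc[k] D := f

/-- A coalgebra isomorphism is an isomorphism of the category. -/
@[simps]
def isoOfEquiv {C D : CoCoalg k} (e : C ≃ₗc[k] D) : C ≅ D where
  hom := (e : C →ₗc[k] D)
  inv := (e.symm : D →ₗc[k] C)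
  hom_inv_id := DFunLike.ext (F := C →ₗc[k] C) _ _ e.symm_apply_apply
  inv_hom_id := DFunLike.ext (F := D →ₗc[k] D) _ _ e.apply_symm_apply

instance : MonoidalCategoryStruct (CoCoalg k) where
  tensorObj C D := ⟨C ⊗[k] D⟩
  tensorHom f g := Coalgebra.TensorProduct.map (R := k) (S := k)
    (Hom.toCoalgHom f) (Hom.toCoalgHom g)
  whiskerLeft C _ _ f := Coalgebra.TensorProduct.map (R := k) (S := k)
    (CoalgHom.id k C) (Hom.toCoalgHom f)
  whiskerRight f C := Coalgebra.TensorProduct.map (R := k) (S := k)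
    (Hom.toCoalgHom f) (CoalgHom.id k C)
  tensorUnit := ⟨k⟩
  associator C D E := isoOfEquiv (Coalgebra.TensorProduct.assoc k k C D E)
  leftUnitor C := isoOfEquiv (Coalgebra.TensorProduct.lid k C)
  rightUnitor C := isoOfEquiv (Coalgebra.TensorProduct.rid k k C)

/-- The forgetful functor to vector spaces. -/
@[simps]
def forget : CoCoalg k ⥤ ModuleCat.{u} k where
  obj C := ModuleCat.of k C
  map f := ModuleCat.ofHom (Hom.toCoalgHom f).toLinearMap

instance : (forget (k := k)).Faithful where
  map_injective {C D} f g h := by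
    refine DFunLike.ext (F := C →ₗc[k] D) f g fun x => ?_
    exact congrArg (fun φ => φ.hom x) h

/-- The tensor product of coalgebras is the tensor product of vector spaces. -/
def inducingFunctorData : Monoidal.InducingFunctorData (forget (k := k)) where
  μIso _ _ := Iso.refl _
  whiskerLeft_eq X Y Z f := by ext; rfl
  whiskerRight_eq X f := by ext; rfl
  tensorHom_eq f g := by ext; rfl
  εIso := Iso.refl _
  associator_eq X Y Z := ModuleCat.hom_ext <| TensorProduct.ext <| TensorProduct.ext <| by ext; rfl
  leftUnitor_eq X := ModuleCat.hom_ext <| TensorProduct.ext <| by ext; rfl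
  rightUnitor_eq X := ModuleCat.hom_ext <| TensorProduct.ext <| by ext; rfl

instance : MonoidalCategory (CoCoalg k) :=
  Monoidal.induced forget inducingFunctorData

/-- The flip `C ⊗ D → D ⊗ C`, as a morphism of coalgebras. -/
def braidingHom (C D : CoCoalg k) : C ⊗ D ⟶ D ⊗ C :=
  show C ⊗[k] D →ₗc[k] D ⊗[k] C from
  { TensorProduct.comm k C D with
    counit_comp := by ext; simp [mul_comm]
    map_comp_comul := by
      ext x y
      simp only [TensorProduct.AlgebraTensorModule.curry_apply, TensorProduct.curry_apply,
        LinearMap.restrictScalars_self, LinearMap.comp_apply, LinearEquiv.coe_coe,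
        TensorProduct.comm_tmul, TensorProduct.comul_tmul]
      hopf_tensor_induction Coalgebra.comul (R := k) x with x₁ x₂
      hopf_tensor_induction Coalgebra.comul (R := k) y with y₁ y₂
      simp }

instance : SymmetricCategory (CoCoalg k) where
  braiding C D :=
    { hom := braidingHom C D
      inv := braidingHom D C
      hom_inv_id := forget.map_injective <| ModuleCat.hom_ext <| TensorProduct.ext <| by ext; rfl
      inv_hom_id := forget.map_injective <| ModuleCat.hom_ext <| TensorProduct.ext <| by ext; rfl }
  braiding_naturality_right _ _ _ f :=
    forget.map_injective <| ModuleCat.hom_ext <| TensorProduct.ext <| by ext; rfl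
  braiding_naturality_left f Z :=
    forget.map_injective <| ModuleCat.hom_ext <| TensorProduct.ext <| by ext; rfl
  hexagon_forward X Y Z := forget.map_injective <| ModuleCat.hom_ext <|
    TensorProduct.ext <| TensorProduct.ext <| by ext; rfl
  hexagon_reverse X Y Z := forget.map_injective <| ModuleCat.hom_ext <|
    TensorProduct.ext <| LinearMap.ext fun _ => TensorProduct.ext <| by ext; rfl
  symmetry X Y := forget.map_injective <| ModuleCat.hom_ext <| TensorProduct.ext <| by ext; rfl

end CoCoalg

/-! ### The global category of comodules -/

/-- A (left) comodule over the coalgebra `C`. -/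
structure Comodule {k : Type u} [Field k] (C : CoCoalg k) : Type (u + 1) where
  carrier : Type u
  [addCommGroup : AddCommGroup carrier]
  [module : Module k carrier]
  coact : carrier →ₗ[k] C ⊗[k] carrier
  coassoc : TensorProduct.assoc k C C carrier ∘ₗ
      (Coalgebra.comul (R := k) (A := C)).rTensor carrier ∘ₗ coact = coact.lTensor C ∘ₗ coact
  counit_coact : TensorProduct.lid k carrier ∘ₗ
      (Coalgebra.counit (R := k) (A := C)).rTensor carrier ∘ₗ coact = LinearMap.id

attribute [instance] Comodule.addCommGroup Comodule.module

instance {k : Type u} [Field k] {C : CoCoalg k} : CoeSort (Comodule C) (Type u) :=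
  ⟨Comodule.carrier⟩

/-- A morphism of `C`-comodules. -/
structure ComoduleHom {k : Type u} [Field k] {C : CoCoalg k} (D E : Comodule C) where
  toLinearMap : D →ₗ[k] E
  coact_comp : E.coact ∘ₗ toLinearMap = toLinearMap.lTensor C ∘ₗ D.coact

section
variable {k C D : Type*} [CommRing k] [AddCommGroup C] [Module k C] [AddCommGroup D] [Module k D]

theorem lid_tensorCoact (w : C ⊗[k] D) :
    (TensorProduct.lid k D).toLinearMap.lTensor C
      ((TensorProduct.lid k C).toLinearMap.rTensor (k ⊗[k] D)
        (TensorProduct.tensorTensorTensorComm k k k C D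
          (Coalgebra.comul (R := k) (1 : k) ⊗ₜ[k] w))) = w := by
  hopf_tensor_induction w with a b
  simp

theorem rid_tensorCoact (w : C ⊗[k] D) :
    (TensorProduct.rid k D).toLinearMap.lTensor C
      ((TensorProduct.rid k C).toLinearMap.rTensor (D ⊗[k] k)
        (TensorProduct.tensorTensorTensorComm k C D k k
          (w ⊗ₜ[k] Coalgebra.comul (R := k) (1 : k)))) = w := by
  hopf_tensor_induction w with a b
  simp

end

section
variable {k C C' D E : Type*} [CommRing k] [AddCommGroup C] [Module k C] [Coalgebra k C]
  [AddCommGroup C'] [Module k C'] [Coalgebra k C'] [AddCommGroup D] [Module k D]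
  [AddCommGroup E] [Module k E]

/-- The coaction of `C ⊗ C'` on `D ⊗ E`: `d ⊗ e ↦ (d₍₀₎ ⊗ e₍₀₎) ⊗ (d₍₁₎ ⊗ e₍₁₎)`. -/
def tensorCoact (ρ : D →ₗ[k] C ⊗[k] D) (σ : E →ₗ[k] C' ⊗[k] E) :
    D ⊗[k] E →ₗ[k] (C ⊗[k] C') ⊗[k] (D ⊗[k] E) :=
  (TensorProduct.tensorTensorTensorComm k C D C' E).toLinearMap ∘ₗ TensorProduct.map ρ σ

theorem tensorCoact_coassoc (ρ : D →ₗ[k] C ⊗[k] D) (σ : E →ₗ[k] C' ⊗[k] E)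
    (hρ : TensorProduct.assoc k C C D ∘ₗ
      (Coalgebra.comul (R := k) (A := C)).rTensor D ∘ₗ ρ = ρ.lTensor C ∘ₗ ρ)
    (hσ : TensorProduct.assoc k C' C' E ∘ₗ
      (Coalgebra.comul (R := k) (A := C')).rTensor E ∘ₗ σ = σ.lTensor C' ∘ₗ σ) :
    TensorProduct.assoc k (C ⊗[k] C') (C ⊗[k] C') (D ⊗[k] E) ∘ₗ
      (Coalgebra.comul (R := k) (A := C ⊗[k] C')).rTensor (D ⊗[k] E) ∘ₗ tensorCoact ρ σ =
    (tensorCoact ρ σ).lTensor (C ⊗[k] C') ∘ₗ tensorCoact ρ σ := by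
  ext x y
  have hx := LinearMap.congr_fun hρ x
  have hy := LinearMap.congr_fun hσ y
  let F : (C ⊗[k] (C ⊗[k] D)) ⊗[k] (C' ⊗[k] (C' ⊗[k] E)) →ₗ[k]
      (C ⊗[k] C') ⊗[k] ((C ⊗[k] C') ⊗[k] (D ⊗[k] E)) :=
    (TensorProduct.tensorTensorTensorComm k C D C' E).toLinearMap.lTensor (C ⊗[k] C') ∘ₗ
      (TensorProduct.tensorTensorTensorComm k C (C ⊗[k] D) C' (C' ⊗[k] E)).toLinearMap
  have h := congrArg₂ (fun a b => F (a ⊗ₜ[k] b)) hx hy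
  simp only [LinearMap.comp_apply] at h
  simp only [tensorCoact, TensorProduct.AlgebraTensorModule.curry_apply,
    TensorProduct.curry_apply, LinearMap.restrictScalars_self, LinearMap.comp_apply,
    TensorProduct.map_tmul]
  refine Eq.trans ?_ (h.trans ?_)
  · generalize ρ x = a
    generalize σ y = b
    hopf_tensor_induction a with a₁ a₂
    hopf_tensor_induction b with b₁ b₂
    simp only [LinearMap.rTensor_tmul, LinearEquiv.coe_coe,
      TensorProduct.tensorTensorTensorComm_tmul, TensorProduct.comul_tmul]
    hopf_tensor_induction Coalgebra.comul (R := k) a₁ with x₁ x₂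
    hopf_tensor_induction Coalgebra.comul (R := k) b₁ with y₁ y₂
    rfl
  · generalize ρ x = a
    generalize σ y = b
    hopf_tensor_induction a with a₁ a₂
    hopf_tensor_induction b with b₁ b₂
    rfl

theorem tensorCoact_counit (ρ : D →ₗ[k] C ⊗[k] D) (σ : E →ₗ[k] C' ⊗[k] E)
    (hρ : TensorProduct.lid k D ∘ₗ
      (Coalgebra.counit (R := k) (A := C)).rTensor D ∘ₗ ρ = LinearMap.id)
    (hσ : TensorProduct.lid k E ∘ₗ
      (Coalgebra.counit (R := k) (A := C')).rTensor E ∘ₗ σ = LinearMap.id) :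
    TensorProduct.lid k (D ⊗[k] E) ∘ₗ
      (Coalgebra.counit (R := k) (A := C ⊗[k] C')).rTensor (D ⊗[k] E) ∘ₗ tensorCoact ρ σ =
    LinearMap.id := by
  ext x y
  have hx := LinearMap.congr_fun hρ x
  have hy := LinearMap.congr_fun hσ y
  have h := congrArg₂ (fun a b => a ⊗ₜ[k] b) hx hy
  simp only [LinearMap.comp_apply, LinearMap.id_apply] at h
  simp only [tensorCoact, TensorProduct.AlgebraTensorModule.curry_apply,
    TensorProduct.curry_apply, LinearMap.restrictScalars_self, LinearMap.comp_apply,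
    TensorProduct.map_tmul, LinearMap.id_apply]
  refine Eq.trans ?_ h
  generalize ρ x = a
  generalize σ y = b
  hopf_tensor_induction a with a₁ a₂
  hopf_tensor_induction b with b₁ b₂
  simp only [LinearMap.rTensor_tmul, LinearEquiv.coe_coe,
    TensorProduct.tensorTensorTensorComm_tmul, TensorProduct.counit_tmul,
    TensorProduct.lid_tmul, TensorProduct.smul_tmul_smul, smul_eq_mul, mul_comm]

end

/-- A pair `(C, D)` of a cocommutative coalgebra `C` and a `C`-comodule `D`. -/
structure Comod (k : Type u) [Field k] : Type (u + 1) where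
  coalg : CoCoalg k
  comod : Comodule coalg

namespace Comod

variable {k : Type u} [Field k]

/-- A morphism `(C, D) → (C', D')`: a coalgebra map `C → C'` and a linear map `D → D'` which is
a map of `C'`-comodules when `D` is a `C'`-comodule by corestriction along `C → C'`. -/
@[ext]
structure Hom (X Y : Comod k) where
  coalg : X.coalg ⟶ Y.coalg
  comod : X.comod →ₗ[k] Y.comod
  coact_comp : Y.comod.coact ∘ₗ comod =
    comod.lTensor Y.coalg ∘ₗ
      (CoCoalg.Hom.toCoalgHom coalg).toLinearMap.rTensor X.comod ∘ₗ X.comod.coact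

instance : Category (Comod k) where
  Hom := Hom
  id X := ⟨𝟙 X.coalg, LinearMap.id, by
    rw [LinearMap.lTensor_id,
      show (CoCoalg.Hom.toCoalgHom (𝟙 X.coalg)).toLinearMap = LinearMap.id from rfl,
      LinearMap.rTensor_id]
    rfl⟩
  comp {X Y Z} f g := ⟨f.coalg ≫ g.coalg, g.comod ∘ₗ f.comod, by
    rw [← LinearMap.comp_assoc, g.coact_comp, LinearMap.comp_assoc, LinearMap.comp_assoc,
      f.coact_comp]
    ext x
    simp only [LinearMap.comp_apply]
    generalize X.comod.coact x = w
    induction w with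
    | zero => simp only [map_zero]
    | add a b ha hb => simp only [map_add, ha, hb]
    | tmul a b => rfl⟩

@[ext]
theorem hom_ext {X Y : Comod k} {f g : X ⟶ Y} (h₁ : f.coalg = g.coalg) (h₂ : f.comod = g.comod) :
    f = g := Hom.ext h₁ h₂

/-- The tensor product `D ⊗ E` of a `C`-comodule and a `C'`-comodule, as a `C ⊗ C'`-comodule:
`d ⊗ e ↦ (d₍₀₎ ⊗ e₍₀₎) ⊗ (d₍₁₎ ⊗ e₍₁₎)`. -/
def tensorComodule {C C' : CoCoalg k} (D : Comodule C) (E : Comodule C') :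
    Comodule (C ⊗ C') where
  carrier := D ⊗[k] E
  coact := tensorCoact D.coact E.coact
  coassoc := tensorCoact_coassoc _ _ D.coassoc E.coassoc
  counit_coact := tensorCoact_counit _ _ D.counit_coact E.counit_coact

/-- The ground field, as a comodule over itself. -/
def unitComodule : Comodule (𝟙_ (CoCoalg k)) where
  carrier := k
  coact := Coalgebra.comul (R := k) (A := k)
  coassoc := Coalgebra.coassoc
  counit_coact := by
    ext
    exact one_mul 1

/-- An isomorphism from an isomorphism of coalgebras and a linear equivalence. -/
@[simps]
def mkIso {X Y : Comod k} (e : X.coalg ≅ Y.coalg) (l : X.comod ≃ₗ[k] Y.comod)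
    (h : Y.comod.coact ∘ₗ l.toLinearMap = l.toLinearMap.lTensor Y.coalg ∘ₗ
      (CoCoalg.Hom.toCoalgHom e.hom).toLinearMap.rTensor X.comod ∘ₗ X.comod.coact) : X ≅ Y where
  hom := ⟨e.hom, l, h⟩
  inv := ⟨e.inv, l.symm, by
    have he (z) : CoCoalg.Hom.toCoalgHom e.inv (CoCoalg.Hom.toCoalgHom e.hom z) = z :=
      congrArg (fun φ => CoCoalg.Hom.toCoalgHom φ z) e.hom_inv_id
    ext y
    obtain ⟨x, rfl⟩ := l.surjective y
    have hx := LinearMap.congr_fun h x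
    simp only [LinearMap.comp_apply, LinearEquiv.coe_coe] at hx ⊢
    rw [hx, l.symm_apply_apply]
    generalize X.comod.coact x = w
    induction w with
    | zero => simp only [LinearMap.map_zero]
    | add a b ha hb => simp only [LinearMap.map_add, ← ha, ← hb]
    | tmul a b =>
      simp only [LinearMap.rTensor_tmul, LinearMap.lTensor_tmul, LinearEquiv.coe_coe,
        l.symm_apply_apply]
      exact congrArg (fun c => c ⊗ₜ[k] b) (he a).symm⟩
  hom_inv_id := hom_ext e.hom_inv_id (LinearMap.ext l.symm_apply_apply)
  inv_hom_id := hom_ext e.inv_hom_id (LinearMap.ext l.apply_symm_apply)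

/-- The tensor product of two morphisms. -/
def tensorMap {X X' Y Y' : Comod k} (f : X ⟶ X') (g : Y ⟶ Y') :
    (⟨X.coalg ⊗ Y.coalg, tensorComodule X.comod Y.comod⟩ : Comod k) ⟶
      ⟨X'.coalg ⊗ Y'.coalg, tensorComodule X'.comod Y'.comod⟩ where
  coalg := f.coalg ⊗ₘ g.coalg
  comod := TensorProduct.map f.comod g.comod
  coact_comp := by
    refine TensorProduct.ext' fun x y => ?_
    have hx := LinearMap.congr_fun f.coact_comp x
    have hy := LinearMap.congr_fun g.coact_comp y
    simp only [LinearMap.comp_apply] at hx hy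
    change TensorProduct.tensorTensorTensorComm k _ _ _ _
      (X'.comod.coact (f.comod x) ⊗ₜ[k] Y'.comod.coact (g.comod y)) =
      (TensorProduct.map f.comod g.comod).lTensor _
        ((TensorProduct.map (CoCoalg.Hom.toCoalgHom f.coalg).toLinearMap
          (CoCoalg.Hom.toCoalgHom g.coalg).toLinearMap).rTensor _
          (TensorProduct.tensorTensorTensorComm k _ _ _ _
            (X.comod.coact x ⊗ₜ[k] Y.comod.coact y)))
    rw [hx, hy]
    generalize X.comod.coact x = a
    generalize Y.comod.coact y = b
    hopf_tensor_induction a with a₁ a₂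
    hopf_tensor_induction b with b₁ b₂
    rfl

instance : MonoidalCategoryStruct (Comod k) where
  tensorObj X Y := ⟨X.coalg ⊗ Y.coalg, tensorComodule X.comod Y.comod⟩
  tensorHom f g := tensorMap f g
  whiskerLeft X _ _ f := tensorMap (𝟙 X) f
  whiskerRight f X := tensorMap f (𝟙 X)
  tensorUnit := ⟨𝟙_ (CoCoalg k), unitComodule⟩
  associator X Y Z := mkIso (α_ X.coalg Y.coalg Z.coalg)
    (TensorProduct.assoc k X.comod Y.comod Z.comod) <| by
      refine TensorProduct.ext <| TensorProduct.ext <|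
        LinearMap.ext fun x => LinearMap.ext fun y => LinearMap.ext fun z => ?_
      change TensorProduct.tensorTensorTensorComm k _ _ _ _ (X.comod.coact x ⊗ₜ[k]
          TensorProduct.tensorTensorTensorComm k _ _ _ _
            (Y.comod.coact y ⊗ₜ[k] Z.comod.coact z)) =
        (TensorProduct.assoc k X.comod Y.comod Z.comod).toLinearMap.lTensor _
          ((TensorProduct.assoc k X.coalg Y.coalg Z.coalg).toLinearMap.rTensor _
            (TensorProduct.tensorTensorTensorComm k _ _ _ _
              (TensorProduct.tensorTensorTensorComm k _ _ _ _
                (X.comod.coact x ⊗ₜ[k] Y.comod.coact y) ⊗ₜ[k] Z.comod.coact z)))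
      generalize X.comod.coact x = a
      generalize Y.comod.coact y = b
      generalize Z.comod.coact z = c
      hopf_tensor_induction a with a₁ a₂
      hopf_tensor_induction b with b₁ b₂
      hopf_tensor_induction c with c₁ c₂
      rfl
  leftUnitor X := mkIso (λ_ X.coalg) (TensorProduct.lid k X.comod) <| by
    refine TensorProduct.ext <| LinearMap.ext_ring <| LinearMap.ext fun x => ?_
    change X.comod.coact ((1 : k) • x) =
      (TensorProduct.lid k X.comod).toLinearMap.lTensor _
        ((TensorProduct.lid k X.coalg).toLinearMap.rTensor _
          (TensorProduct.tensorTensorTensorComm k _ _ _ _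
            (Coalgebra.comul (R := k) (1 : k) ⊗ₜ[k] X.comod.coact x)))
    rw [one_smul]
    exact (lid_tensorCoact _).symm
  rightUnitor X := mkIso (ρ_ X.coalg) (TensorProduct.rid k X.comod) <| by
    refine TensorProduct.ext <| LinearMap.ext fun x => LinearMap.ext_ring ?_
    change X.comod.coact ((1 : k) • x) =
      (TensorProduct.rid k X.comod).toLinearMap.lTensor _
        ((TensorProduct.rid k X.coalg).toLinearMap.rTensor _
          (TensorProduct.tensorTensorTensorComm k _ _ _ _
            (X.comod.coact x ⊗ₜ[k] Coalgebra.comul (R := k) (1 : k))))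
    rw [one_smul]
    exact (rid_tensorCoact _).symm

instance : MonoidalCategory (Comod k) where
  tensorHom_def f g := hom_ext (MonoidalCategory.tensorHom_def f.coalg g.coalg)
    (TensorProduct.ext' fun _ _ => rfl)
  id_tensorHom_id X Y := hom_ext (MonoidalCategory.id_tensorHom_id X.coalg Y.coalg)
    (TensorProduct.ext' fun _ _ => rfl)
  tensorHom_comp_tensorHom f₁ f₂ g₁ g₂ := hom_ext
    (MonoidalCategory.tensorHom_comp_tensorHom f₁.coalg f₂.coalg g₁.coalg g₂.coalg)
    (TensorProduct.ext' fun _ _ => rfl)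
  whiskerLeft_id X Y := hom_ext (MonoidalCategory.whiskerLeft_id X.coalg Y.coalg)
    (TensorProduct.ext' fun _ _ => rfl)
  id_whiskerRight X Y := hom_ext (MonoidalCategory.id_whiskerRight X.coalg Y.coalg)
    (TensorProduct.ext' fun _ _ => rfl)
  associator_naturality f₁ f₂ f₃ := hom_ext
    (MonoidalCategory.associator_naturality f₁.coalg f₂.coalg f₃.coalg)
    (TensorProduct.ext <| TensorProduct.ext' fun _ _ => rfl)
  leftUnitor_naturality f := hom_ext (MonoidalCategory.leftUnitor_naturality f.coalg)
    (TensorProduct.ext' fun c x => (f.comod.map_smul c x).symm)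
  rightUnitor_naturality f := hom_ext (MonoidalCategory.rightUnitor_naturality f.coalg)
    (TensorProduct.ext' fun x c => (f.comod.map_smul c x).symm)
  pentagon W X Y Z := hom_ext
    (MonoidalCategory.pentagon W.coalg X.coalg Y.coalg Z.coalg)
    (TensorProduct.ext <| TensorProduct.ext <| TensorProduct.ext' fun _ _ => rfl)
  triangle X Y := hom_ext (MonoidalCategory.triangle X.coalg Y.coalg)
    (TensorProduct.ext <| TensorProduct.ext' fun x c => LinearMap.ext fun y =>
      have key (c : k) : x ⊗ₜ[k] (c • y) = (c • x) ⊗ₜ[k] y := (TensorProduct.smul_tmul c x y).symm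
      key c)

/-- The flip `(C ⊗ C', D ⊗ D') → (C' ⊗ C, D' ⊗ D)`. -/
def braidingIso (X Y : Comod k) : X ⊗ Y ≅ Y ⊗ X :=
  mkIso (β_ X.coalg Y.coalg) (TensorProduct.comm k X.comod Y.comod) <| by
    refine TensorProduct.ext' fun x y => ?_
    change TensorProduct.tensorTensorTensorComm k _ _ _ _
        (Y.comod.coact y ⊗ₜ[k] X.comod.coact x) =
      (TensorProduct.comm k X.comod Y.comod).toLinearMap.lTensor _
        ((TensorProduct.comm k X.coalg Y.coalg).toLinearMap.rTensor _
          (TensorProduct.tensorTensorTensorComm k _ _ _ _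
            (X.comod.coact x ⊗ₜ[k] Y.comod.coact y)))
    generalize X.comod.coact x = a
    generalize Y.comod.coact y = b
    hopf_tensor_induction a with a₁ a₂
    hopf_tensor_induction b with b₁ b₂
    rfl

instance : SymmetricCategory (Comod k) where
  braiding := braidingIso
  braiding_naturality_right X _ _ f := hom_ext
    (BraidedCategory.braiding_naturality_right X.coalg f.coalg)
    (TensorProduct.ext' fun _ _ => rfl)
  braiding_naturality_left f Z := hom_ext
    (BraidedCategory.braiding_naturality_left f.coalg Z.coalg)
    (TensorProduct.ext' fun _ _ => rfl)
  hexagon_forward X Y Z := hom_ext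
    (BraidedCategory.hexagon_forward X.coalg Y.coalg Z.coalg)
    (TensorProduct.ext <| TensorProduct.ext' fun _ _ => rfl)
  hexagon_reverse X Y Z := hom_ext
    (BraidedCategory.hexagon_reverse X.coalg Y.coalg Z.coalg)
    (TensorProduct.ext <| LinearMap.ext fun _ => TensorProduct.ext' fun _ _ => rfl)
  symmetry X Y := hom_ext (SymmetricCategory.symmetry X.coalg Y.coalg)
    (TensorProduct.ext' fun _ _ => rfl)

end Comod

/-! ### Operads with multiplication and cyclic unital comp modules -/

/-- A non-symmetric operad over `k` with multiplication `(𝒪, m, e)`. The partial composition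
`u ∘ᵢ v ∈ 𝒪 (p + q - 1)` of `u ∈ 𝒪 p` and `v ∈ 𝒪 q` is `comp h i u v`, where the target degree `r`
is pinned down by `h : p + q = r + 1`; positions are numbered from `1`, and `u ∘ᵢ v = 0` outside
the range `1 ≤ i ≤ p` (in particular for `p = 0`). -/
structure OperadWithMul (k : Type u) [Field k] : Type (u + 1) where
  carrier : ℕ → Type u
  [addCommGroup : ∀ n, AddCommGroup (carrier n)]
  [module : ∀ n, Module k (carrier n)]
  comp : ∀ {p q r : ℕ}, p + q = r + 1 → ℕ → (carrier p →ₗ[k] carrier q →ₗ[k] carrier r)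
  /-- The identity operation. -/
  one : carrier 1
  /-- The operad multiplication. -/
  mul : carrier 2
  /-- The unit of the multiplication. -/
  unit : carrier 0
  comp_eq_zero : ∀ {p q r : ℕ} (h : p + q = r + 1) (i : ℕ) (u : carrier p) (v : carrier q),
    i = 0 ∨ p < i → comp h i u v = 0
  comp_comp_of_lt : ∀ {p q r a b n : ℕ} (h₁ : p + q = a + 1) (h₂ : a + r = n + 1)
    (h₃ : p + r = b + 1) (h₄ : b + q = n + 1) (i j : ℕ)
    (u : carrier p) (v : carrier q) (w : carrier r), 1 ≤ j → j < i → i ≤ p →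
    comp h₂ j (comp h₁ i u v) w = comp h₄ (i + r - 1) (comp h₃ j u w) v
  comp_comp_of_mid : ∀ {p q r a b n : ℕ} (h₁ : p + q = a + 1) (h₂ : a + r = n + 1)
    (h₃ : q + r = b + 1) (h₄ : p + b = n + 1) (i j : ℕ)
    (u : carrier p) (v : carrier q) (w : carrier r), 1 ≤ i → i ≤ p → i ≤ j → j < q + i →
    comp h₂ j (comp h₁ i u v) w = comp h₄ i u (comp h₃ (j - i + 1) v w)
  comp_comp_of_ge : ∀ {p q r a b n : ℕ} (h₁ : p + q = a + 1) (h₂ : a + r = n + 1)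
    (h₃ : p + r = b + 1) (h₄ : b + q = n + 1) (i j : ℕ)
    (u : carrier p) (v : carrier q) (w : carrier r), 1 ≤ i → i ≤ p → q + i ≤ j → j ≤ a →
    comp h₂ j (comp h₁ i u v) w = comp h₄ i (comp h₃ (j - q + 1) u w) v
  comp_one : ∀ {p : ℕ} (h : p + 1 = p + 1) (i : ℕ) (u : carrier p), 1 ≤ i → i ≤ p →
    comp h i u one = u
  one_comp : ∀ {p : ℕ} (h : 1 + p = p + 1) (u : carrier p), comp h 1 one u = u
  mul_comp_mul : comp (p := 2) (q := 2) (r := 3) rfl 1 mul mul =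
    comp (p := 2) (q := 2) (r := 3) rfl 2 mul mul
  mul_comp_unit_left : comp (p := 2) (q := 0) (r := 1) rfl 1 mul unit = one
  mul_comp_unit_right : comp (p := 2) (q := 0) (r := 1) rfl 2 mul unit = one

attribute [instance] OperadWithMul.addCommGroup OperadWithMul.module

/-- A cyclic unital (left) comp module `ℒ` over the operad with multiplication `𝒪`. The operation
`u •ᵢ l ∈ ℒ (n - p + 1)` of `u ∈ 𝒪 p` on `l ∈ ℒ n`, for `0 ≤ i ≤ n + 1 - p`, is `act h i u l`, where
the target degree `r = n + 1 - p` is pinned down by `h : r + p = n + 1`; it is set to be zero for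
`i > r`. The three associativity relations below specialise for `p = 0` to the two cases `j < i` and
`i ≤ j`. The cyclic operator `t : ℒ (n + 1) → ℒ (n + 1)` is `cyc n`. -/
structure CyclicCompModule {k : Type u} [Field k] (O : OperadWithMul k) : Type (u + 1) where
  carrier : ℕ → Type u
  [addCommGroup : ∀ n, AddCommGroup (carrier n)]
  [module : ∀ n, Module k (carrier n)]
  act : ∀ {p n r : ℕ}, r + p = n + 1 → ℕ → (O.carrier p →ₗ[k] carrier n →ₗ[k] carrier r)
  act_eq_zero : ∀ {p n r : ℕ} (h : r + p = n + 1) (i : ℕ) (u : O.carrier p) (l : carrier n),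
    r < i → act h i u l = 0
  act_act_of_lt : ∀ {p q n a b r : ℕ} (h₁ : a + q = n + 1) (h₂ : r + p = a + 1)
    (h₃ : b + p = n + 1) (h₄ : r + q = b + 1) (i j : ℕ)
    (u : O.carrier p) (v : O.carrier q) (l : carrier n), j < i → i ≤ r →
    act h₂ i u (act h₁ j v l) = act h₄ j v (act h₃ (i + q - 1) u l)
  act_act_of_mid : ∀ {p q n a s r : ℕ} (h₁ : a + q = n + 1) (h₂ : r + p = a + 1)
    (h₃ : p + q = s + 1) (h₄ : r + s = n + 1) (i j : ℕ)
    (u : O.carrier p) (v : O.carrier q) (l : carrier n), i ≤ j → j < i + p → i ≤ r → j ≤ a →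
    act h₂ i u (act h₁ j v l) = act h₄ i (O.comp h₃ (j - i + 1) u v) l
  act_act_of_ge : ∀ {p q n a b r : ℕ} (h₁ : a + q = n + 1) (h₂ : r + p = a + 1)
    (h₃ : b + p = n + 1) (h₄ : r + q = b + 1) (i j : ℕ)
    (u : O.carrier p) (v : O.carrier q) (l : carrier n), i + p ≤ j → j ≤ a →
    act h₂ i u (act h₁ j v l) = act h₄ (j - p + 1) v (act h₃ i u l)
  one_act : ∀ {n : ℕ} (h : n + 1 = n + 1) (i : ℕ) (l : carrier n), i ≤ n → act h i O.one l = l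
  cyc : ∀ n : ℕ, carrier (n + 1) →ₗ[k] carrier (n + 1)
  cyc_act : ∀ {p n r : ℕ} (h : (r + 1) + p = (n + 1) + 1) (i : ℕ) (u : O.carrier p)
    (l : carrier (n + 1)), i ≤ r → cyc r (act h i u l) = act h (i + 1) u (cyc n l)
  cyc_pow : ∀ n : ℕ, cyc n ^ (n + 2) = 1

attribute [instance] CyclicCompModule.addCommGroup CyclicCompModule.module

/-! ### Measurings -/

/-- A `C`-measuring from `𝒪` to `𝒪'`, for a cocommutative coalgebra `C`. The first condition reads
`Ψ(x)(u ∘ᵢ v) = ∑ Ψ(x₍₁₎)(u) ∘'ᵢ Ψ(x₍₂₎)(v)`. -/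
structure OperadMeasuring {k : Type u} [Field k] (C : CoCoalg k) (O O' : OperadWithMul k) where
  map : ∀ n : ℕ, C →ₗ[k] O.carrier n →ₗ[k] O'.carrier n
  map_comp : ∀ {p q r : ℕ} (h : p + q = r + 1) (i : ℕ) (x : C) (u : O.carrier p)
    (v : O.carrier q),
    map r x (O.comp h i u v) =
      TensorProduct.lift ((O'.comp h i).compl₁₂ ((map p).flip u) ((map q).flip v))
        (Coalgebra.comul (R := k) x)
  map_mul : ∀ x : C, map 2 x O.mul = Coalgebra.counit (R := k) x • O'.mul
  map_unit : ∀ x : C, map 0 x O.unit = Coalgebra.counit (R := k) x • O'.unit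

/-- `Φ` is a universal measuring: every measuring by a cocommutative coalgebra factors through it
along a unique coalgebra map. -/
def OperadMeasuring.IsUniversal {k : Type u} [Field k] {M : CoCoalg k} {O O' : OperadWithMul k}
    (Φ : OperadMeasuring M O O') : Prop :=
  ∀ (C : CoCoalg k) (Ψ : OperadMeasuring C O O'),
    ∃! ξ : C →ₗc[k] M, ∀ (n : ℕ) (x : C), Φ.map n (ξ x) = Ψ.map n x

/-- A `(C, Ψ)`-comodule measuring from `ℒ` to `ℒ'` given by the `C`-comodule `D`. The first
condition reads `Ω(y)(u •ᵢ l) = ∑ Ψ(y₍₀₎)(u) •ᵢ Ω(y₍₁₎)(l)`. -/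
structure ComoduleMeasuring {k : Type u} [Field k] {C : CoCoalg k} {O O' : OperadWithMul k}
    (Ψ : OperadMeasuring C O O') (D : Comodule C)
    (L : CyclicCompModule O) (L' : CyclicCompModule O') where
  map : ∀ n : ℕ, D →ₗ[k] L.carrier n →ₗ[k] L'.carrier n
  map_act : ∀ {p n r : ℕ} (h : r + p = n + 1) (i : ℕ), i ≤ r → ∀ (y : D) (u : O.carrier p)
    (l : L.carrier n),
    map r y (L.act h i u l) =
      TensorProduct.lift ((L'.act h i).compl₁₂ ((Ψ.map p).flip u) ((map n).flip l)) (D.coact y)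
  map_cyc : ∀ (n : ℕ) (y : D) (l : L.carrier (n + 1)),
    map (n + 1) y (L.cyc n l) = L'.cyc n (map (n + 1) y l)

/-- `Θ` is a universal `(C, Ψ)`-comodule measuring: every `(C, Ψ)`-comodule measuring factors
through it along a unique map of `C`-comodules. -/
def ComoduleMeasuring.IsUniversal {k : Type u} [Field k] {C : CoCoalg k} {O O' : OperadWithMul k}
    {Ψ : OperadMeasuring C O O'} {Q : Comodule C} {L : CyclicCompModule O}
    {L' : CyclicCompModule O'} (Θ : ComoduleMeasuring Ψ Q L L') : Prop :=
  ∀ (D : Comodule C) (Ω : ComoduleMeasuring Ψ D L L'),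
    ∃! χ : ComoduleHom D Q, ∀ (n : ℕ) (y : D), Θ.map n (χ.toLinearMap y) = Ω.map n y

/-! ### Enrichments with prescribed hom-objects -/

/-- The structure of a `V`-enriched category on the objects `X : ι` with the prescribed hom-objects
`H X Y : V`. -/
structure Enrichment {V : Type*} [Category V] [MonoidalCategory V] {ι : Type*}
    (H : ι → ι → V) where
  id (X : ι) : 𝟙_ V ⟶ H X X
  comp (X Y Z : ι) : H X Y ⊗ H Y Z ⟶ H X Z
  id_comp (X Y : ι) : (λ_ (H X Y)).inv ≫ id X ▷ _ ≫ comp X X Y = 𝟙 _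
  comp_id (X Y : ι) : (ρ_ (H X Y)).inv ≫ _ ◁ id Y ≫ comp X Y Y = 𝟙 _
  assoc (W X Y Z : ι) : (α_ _ _ _).inv ≫ comp W X Y ▷ _ ≫ comp W Y Z =
    _ ◁ comp X Y Z ≫ comp W X Z

/-- An `Enrichment` is an enriched category in the sense of Mathlib. -/
@[reducible]
def Enrichment.toEnrichedCategory {V : Type*} [Category V] [MonoidalCategory V] {ι : Type*}
    {H : ι → ι → V} (S : Enrichment H) : EnrichedCategory V ι where
  Hom := H
  id := S.id
  comp := S.comp
  id_comp := S.id_comp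
  comp_id := S.comp_id
  assoc := S.assoc

/-- The identities and the composition of an enrichment of operads over cocommutative coalgebras are
those induced, through the measurings `Φ`, by identity maps and the composition of linear maps. -/
structure Enrichment.InducedByOperads {k : Type u} [Field k]
    {M : OperadWithMul k → OperadWithMul k → CoCoalg k} (S : Enrichment M)
    (Φ : ∀ O O', OperadMeasuring (M O O') O O') : Prop where
  id : ∀ (O : OperadWithMul k) (n : ℕ) (c : k),
    (Φ O O).map n (CoCoalg.Hom.toCoalgHom (S.id O) c) = c • LinearMap.id
  comp : ∀ (O O' O'' : OperadWithMul k) (n : ℕ) (x : M O O') (x' : M O' O''),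
    (Φ O O'').map n (CoCoalg.Hom.toCoalgHom (S.comp O O' O'') (x ⊗ₜ[k] x')) =
      (Φ O' O'').map n x' ∘ₗ (Φ O O').map n x

/-- A pair `(𝒪, ℒ)` of an operad with multiplication and a cyclic unital comp module over it. -/
structure CompPair (k : Type u) [Field k] : Type (u + 1) where
  operad : OperadWithMul k
  mod : CyclicCompModule operad

/-- The identities and the composition of an enrichment of pairs `(𝒪, ℒ)` over comodules are
those of the enrichment `S` of operads on the coalgebra component, and are induced, through the
measurings `Θ`, by identity maps and the composition of linear maps on the comodule component. -/
structure Enrichment.InducedByPairs {k : Type u} [Field k]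
    {M : OperadWithMul k → OperadWithMul k → CoCoalg k}
    {Φ : ∀ O O', OperadMeasuring (M O O') O O'}
    {Q : ∀ X Y : CompPair k, Comodule (M X.operad Y.operad)}
    (T : Enrichment (V := Comod k) fun X Y : CompPair k => ⟨M X.operad Y.operad, Q X Y⟩)
    (S : Enrichment M)
    (Θ : ∀ X Y, ComoduleMeasuring (Φ X.operad Y.operad) (Q X Y) X.mod Y.mod) : Prop where
  id_coalg : ∀ X : CompPair k, (T.id X).coalg = S.id X.operad
  comp_coalg : ∀ X Y Z : CompPair k,
    (T.comp X Y Z).coalg = S.comp X.operad Y.operad Z.operad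
  id_comod : ∀ (X : CompPair k) (n : ℕ) (c : k),
    (Θ X X).map n ((T.id X).comod c) = c • LinearMap.id
  comp_comod : ∀ (X Y Z : CompPair k) (n : ℕ) (y : Q X Y) (y' : Q Y Z),
    (Θ X Z).map n ((T.comp X Y Z).comod (y ⊗ₜ[k] y')) = (Θ Y Z).map n y' ∘ₗ (Θ X Y).map n y

end Measuring

end

open Measuring

/-! ### Coideals -/

section Coideal

open TensorProduct

variable {k C D : Type*} [Field k] [AddCommGroup C] [Module k C] [Coalgebra k C]
  [AddCommGroup D] [Module k D] [Coalgebra k D]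

theorem Submodule.isCoideal_sSup (S : Set (Submodule k C)) (hS : ∀ I ∈ S, I.IsCoideal) :
    (sSup S).IsCoideal := by
  rw [Submodule.isCoideal_iff]
  constructor
  · have : sSup S ≤ LinearMap.ker (Coalgebra.counit (R := k) (A := C)) :=
      sSup_le fun I hI x hx => (hS I hI).counit_eq_zero hx
    exact fun x hx => this hx
  · have : sSup S ≤ LinearMap.ker
        (TensorProduct.map (sSup S).mkQ (sSup S).mkQ ∘ₗ Coalgebra.comul (R := k) (A := C)) := by
      refine sSup_le fun I hI x hx => ?_
      have h := (hS I hI).map_mkQ_comul_eq_zero hx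
      let g : C ⧸ I →ₗ[k] C ⧸ sSup S := Submodule.factor (le_sSup hI)
      have hg : (sSup S).mkQ = g ∘ₗ I.mkQ := (Submodule.factor_comp_mk (le_sSup hI)).symm
      rw [LinearMap.mem_ker, LinearMap.comp_apply, hg, TensorProduct.map_comp,
        LinearMap.comp_apply, h, map_zero]
    exact fun x hx => this hx

theorem CoalgHom.isCoideal_ker (f : C →ₗc[k] D) : (LinearMap.ker f.toLinearMap).IsCoideal := by
  rw [Submodule.isCoideal_iff]
  refine ⟨fun x hx => ?_, fun x hx => ?_⟩
  · rw [← CoalgHomClass.counit_comp_apply f x]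
    rw [LinearMap.mem_ker] at hx
    exact (congrArg _ hx).trans (map_zero _)
  · set I := LinearMap.ker f.toLinearMap
    let g : C ⧸ I →ₗ[k] D := I.liftQ f.toLinearMap le_rfl
    have hg : Function.Injective g := LinearMap.ker_eq_bot.1 (Submodule.ker_liftQ_eq_bot' _ _ rfl)
    refine TensorProduct.map_injective_of_flat_flat g g hg hg ?_
    rw [map_zero, ← LinearMap.comp_apply, ← TensorProduct.map_comp, Submodule.liftQ_mkQ]
    have h := LinearMap.congr_fun f.map_comp_comul x
    rw [LinearMap.comp_apply, LinearMap.comp_apply, LinearMap.mem_ker.1 hx, map_zero] at h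
    exact h

theorem Submodule.IsCoideal.map {I : Submodule k C} (hI : I.IsCoideal) (f : C →ₗc[k] D) :
    (I.map f.toLinearMap).IsCoideal := by
  rw [Submodule.isCoideal_iff]
  constructor
  · rintro _ ⟨x, hx, rfl⟩
    exact (CoalgHomClass.counit_comp_apply f x).trans (hI.counit_eq_zero hx)
  · rintro _ ⟨x, hx, rfl⟩
    let g : C ⧸ I →ₗ[k] D ⧸ I.map f.toLinearMap :=
      I.mapQ _ f.toLinearMap (Submodule.le_comap_map _ _)
    have hg : (I.map f.toLinearMap).mkQ ∘ₗ f.toLinearMap = g ∘ₗ I.mkQ := rfl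
    have h := LinearMap.congr_fun f.map_comp_comul x
    rw [LinearMap.comp_apply, LinearMap.comp_apply] at h
    rw [← h, ← LinearMap.comp_apply, ← TensorProduct.map_comp, hg, TensorProduct.map_comp,
      LinearMap.comp_apply, hI.map_mkQ_comul_eq_zero hx, map_zero]

theorem CoalgHom.isCoideal_range_sub (f g : C →ₗc[k] D) :
    (LinearMap.range (f.toLinearMap - g.toLinearMap)).IsCoideal := by
  rw [Submodule.isCoideal_iff]
  set I := LinearMap.range (f.toLinearMap - g.toLinearMap)
  have h : I.mkQ ∘ₗ f.toLinearMap = I.mkQ ∘ₗ g.toLinearMap := by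
    ext x
    exact (Submodule.Quotient.eq I).2 ⟨x, rfl⟩
  have hc (x : C) (φ : C →ₗc[k] D) :
      TensorProduct.map I.mkQ I.mkQ (Coalgebra.comul (R := k) (φ x)) =
      TensorProduct.map (I.mkQ ∘ₗ φ.toLinearMap) (I.mkQ ∘ₗ φ.toLinearMap)
        (Coalgebra.comul (R := k) x) := by
    rw [TensorProduct.map_comp, LinearMap.comp_apply]
    exact congrArg _ (CoalgHomClass.map_comp_comul_apply φ x).symm
  constructor
  · rintro _ ⟨x, rfl⟩
    rw [LinearMap.sub_apply, map_sub, sub_eq_zero]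
    exact (CoalgHomClass.counit_comp_apply f x).trans (CoalgHomClass.counit_comp_apply g x).symm
  · rintro _ ⟨x, rfl⟩
    rw [LinearMap.sub_apply, map_sub, map_sub, sub_eq_zero]
    refine (hc x f).trans (Eq.trans ?_ (hc x g).symm)
    rw [h]

/-- The largest coideal contained in a subspace. -/
def Submodule.largestCoideal (W : Submodule k C) : Submodule k C :=
  sSup {I | I.IsCoideal ∧ I ≤ W}

instance Submodule.isCoideal_largestCoideal (W : Submodule k C) : W.largestCoideal.IsCoideal :=
  Submodule.isCoideal_sSup _ fun _ h => h.1

theorem Submodule.largestCoideal_le (W : Submodule k C) : W.largestCoideal ≤ W :=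
  sSup_le fun _ h => h.2

theorem Submodule.IsCoideal.le_largestCoideal {I W : Submodule k C} (hI : I.IsCoideal)
    (h : I ≤ W) : I ≤ W.largestCoideal :=
  le_sSup ⟨hI, h⟩

/-- In the quotient by the largest coideal contained in `W`, the only coideal contained in
the image of `W` is zero. -/
theorem Submodule.IsCoideal.eq_bot_of_le_map {W : Submodule k C}
    {I : Submodule k (C ⧸ W.largestCoideal)} (hI : I.IsCoideal)
    (h : I ≤ W.map W.largestCoideal.mkQ) : I = ⊥ := by
  have hc : (I.comap W.largestCoideal.mkQ).IsCoideal := by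
    convert ((Coalgebra.Quotient.mkQCoalgHom (R := k) I).comp
      (Coalgebra.Quotient.mkQCoalgHom (R := k) W.largestCoideal)).isCoideal_ker
    ext x
    exact (Submodule.Quotient.mk_eq_zero I).symm
  have hle : I.comap W.largestCoideal.mkQ ≤ W := by
    refine (Submodule.comap_mono h).trans ?_
    rw [Submodule.comap_map_mkQ]
    exact sup_le W.largestCoideal_le le_rfl
  rw [eq_bot_iff]
  intro y hy
  obtain ⟨x, rfl⟩ := Submodule.mkQ_surjective _ y
  exact (Submodule.Quotient.mk_eq_zero _).2 (hc.le_largestCoideal hle hy)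

/-- A coalgebra map that kills the kernel of a surjective coalgebra map factors through it. -/
theorem CoalgHom.exists_comp_eq_of_surjective {E : Type*} [AddCommGroup E] [Module k E]
    [Coalgebra k E] (p : C →ₗc[k] D) (hp : Function.Surjective p) (f : C →ₗc[k] E)
    (h : LinearMap.ker p.toLinearMap ≤ LinearMap.ker f.toLinearMap) :
    ∃ g : D →ₗc[k] E, ∀ x, g (p x) = f x := by
  obtain ⟨g, hg⟩ := LinearMap.exists_rightInverse_of_surjective p.toLinearMap
    (LinearMap.range_eq_top.2 hp)
  have key (x : C) : (f.toLinearMap ∘ₗ g) (p x) = f x := by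
    have : g (p x) - x ∈ LinearMap.ker p.toLinearMap := by
      rw [LinearMap.mem_ker, map_sub, sub_eq_zero]
      exact LinearMap.congr_fun hg (p x)
    have h2 := h this
    rw [LinearMap.mem_ker, map_sub, sub_eq_zero] at h2
    exact h2
  refine ⟨⟨f.toLinearMap ∘ₗ g, ?_, ?_⟩, key⟩
  · ext y
    obtain ⟨x, rfl⟩ := hp y
    rw [LinearMap.comp_apply, key]
    simp
  · ext y
    obtain ⟨x, rfl⟩ := hp y
    rw [LinearMap.comp_apply, LinearMap.comp_apply, key, ← CoalgHomClass.map_comp_comul_apply,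
      ← CoalgHomClass.map_comp_comul_apply, ← LinearMap.comp_apply, ← TensorProduct.map_comp]
    congr 2 <;> exact LinearMap.ext key

end Coideal

/-! ### Finite-dimensional subcoalgebras -/

section Subcoalgebra

open TensorProduct

variable {k C V : Type*} [Field k] [AddCommGroup C] [Module k C] [AddCommGroup V] [Module k V]

theorem LinearMap.exists_comp_eq_of_injective {U W : Type*} [AddCommGroup U] [Module k U]
    [AddCommGroup W] [Module k W] (j : V →ₗ[k] W) (hj : Function.Injective j) (f : U →ₗ[k] W)
    (h : ∀ x, f x ∈ LinearMap.range j) : ∃ g : U →ₗ[k] V, ∀ x, j (g x) = f x := by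
  refine ⟨(LinearEquiv.ofInjective j hj).symm.toLinearMap ∘ₗ f.codRestrict _ h, fun x => ?_⟩
  exact congrArg Subtype.val ((LinearEquiv.ofInjective j hj).apply_symm_apply ⟨f x, h x⟩)

theorem TensorProduct.mem_range_rTensor_subtype (D : Submodule k V) (w : V ⊗[k] C)
    (h : ∀ g : C →ₗ[k] k, TensorProduct.rid k V (g.lTensor V w) ∈ D) :
    w ∈ LinearMap.range (D.subtype.rTensor C) := by
  classical
  let b := Module.Basis.ofVectorSpace k C
  have hc (i) : TensorProduct.equivFinsuppOfBasisRight b w i ∈ D := by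
    convert h (b.coord i)
    clear h
    induction w with
    | zero => simp
    | add x y hx hy => simp only [map_add, Finsupp.add_apply, *]
    | tmul x y => simp
  rw [← (TensorProduct.equivFinsuppOfBasisRight b).symm_apply_apply w,
    TensorProduct.equivFinsuppOfBasisRight_symm_apply]
  exact Submodule.sum_mem _ fun i _ => ⟨⟨_, hc i⟩ ⊗ₜ b i, rfl⟩

theorem TensorProduct.mem_range_map_subtype (D : Submodule k V) (w : V ⊗[k] V)
    (h₁ : w ∈ LinearMap.range (D.subtype.rTensor V))
    (h₂ : w ∈ LinearMap.range (D.subtype.lTensor V)) :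
    w ∈ LinearMap.range (TensorProduct.map D.subtype D.subtype) := by
  obtain ⟨p, hp⟩ := D.subtype.exists_leftInverse_of_injective (Submodule.ker_subtype D)
  have e₁ : (D.subtype ∘ₗ p).rTensor V w = w := by
    obtain ⟨w, rfl⟩ := h₁
    rw [← LinearMap.comp_apply, ← LinearMap.rTensor_comp, LinearMap.comp_assoc, hp]
    rfl
  have e₂ : (D.subtype ∘ₗ p).lTensor V w = w := by
    obtain ⟨w, rfl⟩ := h₂
    rw [← LinearMap.comp_apply, ← LinearMap.lTensor_comp, LinearMap.comp_assoc, hp]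
    rfl
  refine ⟨TensorProduct.map p p w, ?_⟩
  rw [← LinearMap.comp_apply, ← TensorProduct.map_comp, ← LinearMap.rTensor_comp_lTensor,
    LinearMap.comp_apply, e₂, e₁]

variable [Coalgebra k C]

/-- The coalgebra structure on the source of an injective linear map whose image is a
subcoalgebra. -/
theorem exists_coalgebra_of_injective (j : V →ₗ[k] C) (hj : Function.Injective j)
    (h : ∀ v, Coalgebra.comul (R := k) (j v) ∈ LinearMap.range (TensorProduct.map j j)) :
    ∃ (_ : Coalgebra k V) (f : V →ₗc[k] C), ∀ v, f v = j v := by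
  obtain ⟨δ, hδ⟩ := LinearMap.exists_comp_eq_of_injective (TensorProduct.map j j)
    (TensorProduct.map_injective_of_flat_flat j j hj hj) (Coalgebra.comul (R := k) ∘ₗ j) h
  let s : CoalgebraStruct k V := ⟨δ, Coalgebra.counit (R := k) ∘ₗ j⟩
  have hr (w : V ⊗[k] V) : TensorProduct.map j (TensorProduct.map j j)
      (TensorProduct.assoc k V V V (δ.rTensor V w)) =
      TensorProduct.assoc k C C C
        ((Coalgebra.comul (R := k) (A := C)).rTensor C (TensorProduct.map j j w)) := by
    hopf_tensor_induction w with a b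
    rw [LinearMap.rTensor_tmul, TensorProduct.map_tmul, LinearMap.rTensor_tmul]
    refine Eq.trans ?_ (congrArg (fun z => TensorProduct.assoc k C C C (z ⊗ₜ j b)) (hδ a))
    hopf_tensor_induction δ a with a₁ a₂
    rfl
  have hl (w : V ⊗[k] V) : TensorProduct.map j (TensorProduct.map j j) (δ.lTensor V w) =
      (Coalgebra.comul (R := k) (A := C)).lTensor C (TensorProduct.map j j w) := by
    hopf_tensor_induction w with a b
    exact congrArg (fun z => j a ⊗ₜ[k] z) (hδ b)
  have hcr (w : V ⊗[k] V) : j.lTensor k ((Coalgebra.counit (R := k) ∘ₗ j).rTensor V w) =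
      (Coalgebra.counit (R := k) (A := C)).rTensor C (TensorProduct.map j j w) := by
    hopf_tensor_induction w with a b
    rfl
  have hcl (w : V ⊗[k] V) : j.rTensor k ((Coalgebra.counit (R := k) ∘ₗ j).lTensor V w) =
      (Coalgebra.counit (R := k) (A := C)).lTensor C (TensorProduct.map j j w) := by
    hopf_tensor_induction w with a b
    rfl
  refine ⟨{ s with
    coassoc := ?_
    rTensor_counit_comp_comul := ?_
    lTensor_counit_comp_comul := ?_ }, ⟨j, rfl, LinearMap.ext hδ⟩, fun _ => rfl⟩
  · ext v
    apply TensorProduct.map_injective_of_flat_flat j _ hj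
      (TensorProduct.map_injective_of_flat_flat j j hj hj)
    refine (hr _).trans (Eq.trans ?_ (hl _).symm)
    have h := Coalgebra.coassoc_apply (R := k) (j v)
    rwa [← LinearMap.comp_apply Coalgebra.comul j, ← hδ] at h
  · ext v
    apply Module.Flat.lTensor_preserves_injective_linearMap (M := k) j hj
    refine (hcr _).trans ?_
    refine (congrArg _ (hδ v)).trans ?_
    exact Coalgebra.rTensor_counit_comul (j v)
  · ext v
    apply Module.Flat.rTensor_preserves_injective_linearMap (M := k) j hj
    refine (hcl _).trans ?_
    refine (congrArg _ (hδ v)).trans ?_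
    exact Coalgebra.lTensor_counit_comul (j v)

theorem isCocomm_of_injective [Coalgebra k V] [Coalgebra.IsCocomm k C]
    (f : V →ₗc[k] C) (hf : Function.Injective f) : Coalgebra.IsCocomm k V where
  comm_comp_comul := by
    ext v
    apply TensorProduct.map_injective_of_flat_flat f.toLinearMap f.toLinearMap hf hf
    have h := LinearMap.congr_fun f.map_comp_comul v
    simp only [LinearMap.comp_apply] at h
    rw [h, LinearMap.comp_apply, LinearEquiv.coe_coe, TensorProduct.map_comm, h]
    exact Coalgebra.comm_comul k _

theorem exists_finite_subcoalgebra [Coalgebra.IsCocomm k C] (x : C) :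
    ∃ D : Submodule k C, Module.Finite k D ∧ x ∈ D ∧
      ∀ y ∈ D, Coalgebra.comul (R := k) y ∈
        LinearMap.range (TensorProduct.map D.subtype D.subtype) := by
  let φ : (C →ₗ[k] k) →ₗ[k] C :=
    { toFun := fun g => TensorProduct.rid k C (g.lTensor C (Coalgebra.comul (R := k) x))
      map_add' := fun g h => by rw [LinearMap.lTensor_add, LinearMap.add_apply, map_add]
      map_smul' := fun c g => by
        rw [LinearMap.lTensor_smul, LinearMap.smul_apply, map_smul, RingHom.id_apply] }
  have hφ (h g : C →ₗ[k] k) (w : C ⊗[k] C) :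
      TensorProduct.rid k C (h.lTensor C (Coalgebra.comul (R := k)
        (TensorProduct.rid k C (g.lTensor C w)))) =
      TensorProduct.rid k C ((LinearMap.mul' k k ∘ₗ TensorProduct.map h g).lTensor C
        (TensorProduct.assoc k C C C ((Coalgebra.comul (R := k) (A := C)).rTensor C w))) := by
    hopf_tensor_induction w with a b
    simp only [LinearMap.lTensor_tmul, LinearMap.rTensor_tmul, TensorProduct.rid_tmul, map_smul]
    induction Coalgebra.comul (R := k) a with
    | zero => simp only [map_zero, smul_zero, TensorProduct.zero_tmul]
    | add _ _ h₁ h₂ => simp only [map_add, smul_add, TensorProduct.add_tmul, h₁, h₂]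
    | tmul a₁ a₂ => simp [smul_smul, mul_comm]
  have hr (y) (hy : y ∈ LinearMap.range φ) :
      Coalgebra.comul (R := k) y ∈ LinearMap.range ((LinearMap.range φ).subtype.rTensor C) := by
    refine TensorProduct.mem_range_rTensor_subtype _ _ fun h => ?_
    obtain ⟨g, rfl⟩ := hy
    refine ⟨(LinearMap.mul' k k ∘ₗ TensorProduct.map h g) ∘ₗ Coalgebra.comul (R := k), ?_⟩
    refine Eq.trans ?_ (hφ h g _).symm
    rw [Coalgebra.coassoc_apply]
    change TensorProduct.rid k C (LinearMap.lTensor C _ _) = _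
    rw [LinearMap.lTensor_comp]
    rfl
  refine ⟨LinearMap.range φ, ?_, ⟨Coalgebra.counit (R := k), ?_⟩, fun y hy => ?_⟩
  · classical
    obtain ⟨s, hs⟩ := TensorProduct.exists_finset (Coalgebra.comul (R := k) x)
    have hle : LinearMap.range φ ≤ Submodule.span k ((s.image Prod.fst : Finset C) : Set C) := by
      rintro _ ⟨g, rfl⟩
      change TensorProduct.rid k C (g.lTensor C (Coalgebra.comul (R := k) x)) ∈ _
      rw [hs, map_sum, map_sum]
      refine Submodule.sum_mem _ fun i hi => ?_
      rw [LinearMap.lTensor_tmul, TensorProduct.rid_tmul]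
      exact Submodule.smul_mem _ _ (Submodule.subset_span (by simpa using ⟨i.2, hi⟩))
    exact Submodule.finiteDimensional_of_le hle
  · change TensorProduct.rid k C _ = x
    rw [Coalgebra.lTensor_counit_comul, TensorProduct.rid_tmul, one_smul]
  · refine TensorProduct.mem_range_map_subtype _ _ (hr y hy) ?_
    obtain ⟨w, hw⟩ := hr y hy
    refine ⟨TensorProduct.comm k _ _ w, ?_⟩
    rw [← Coalgebra.comm_comul k y, ← hw]
    clear hw
    hopf_tensor_induction w with a b
    rfl

end Subcoalgebra

/-! ### Universal measuring coalgebras -/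

section

variable {k : Type*} [Field k]

theorem TensorProduct.lift_compl₁₂_map {A B A' B' U V W : Type*}
    [AddCommGroup A] [Module k A] [AddCommGroup B] [Module k B]
    [AddCommGroup A'] [Module k A'] [AddCommGroup B'] [Module k B']
    [AddCommGroup U] [Module k U] [AddCommGroup V] [Module k V] [AddCommGroup W] [Module k W]
    (β : U →ₗ[k] V →ₗ[k] W) (a : A' →ₗ[k] U) (b : B' →ₗ[k] V) (f : A →ₗ[k] A') (g : B →ₗ[k] B')
    (w : A ⊗[k] B) :
    TensorProduct.lift (β.compl₁₂ a b) (TensorProduct.map f g w) =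
      TensorProduct.lift (β.compl₁₂ (a ∘ₗ f) (b ∘ₗ g)) w := by
  hopf_tensor_induction w with x y
  rfl

@[elab_as_elim]
theorem DFinsupp.induction_add {ι : Type*} [DecidableEq ι] {A : ι → Type*}
    [∀ i, AddCommGroup (A i)] {motive : (Π₀ i, A i) → Prop} (x : Π₀ i, A i) (zero : motive 0)
    (add : ∀ x y, motive x → motive y → motive (x + y))
    (single : ∀ i a, motive (DFinsupp.single i a)) : motive x :=
  DFinsupp.induction x zero fun i a _ _ _ hy => add _ _ (single i a) hy

variable {ι : Type*} [DecidableEq ι] {A : ι → Type*} [∀ i, AddCommGroup (A i)]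
  [∀ i, Module k (A i)] [∀ i, Coalgebra k (A i)]
  {C D : Type*} [AddCommGroup C] [Module k C] [Coalgebra k C]
  [AddCommGroup D] [Module k D] [Coalgebra k D]

/-- The inclusion of a summand of a direct sum of coalgebras. -/
noncomputable def CoalgHom.dfinsuppSingle (i : ι) : A i →ₗc[k] Π₀ i, A i where
  toLinearMap := DFinsupp.lsingle i
  counit_comp := DFinsupp.counit_comp_lsingle k ι A i
  map_comp_comul := (DFinsupp.comul_comp_lsingle k ι A i).symm

/-- The coalgebra map from a direct sum given by a family of coalgebra maps. -/
noncomputable def CoalgHom.dfinsuppLift (f : ∀ i, A i →ₗc[k] C) : (Π₀ i, A i) →ₗc[k] C where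
  toLinearMap := DFinsupp.lsum k fun i => (f i).toLinearMap
  counit_comp := by
    refine DFinsupp.lhom_ext' fun i => LinearMap.ext fun x => ?_
    simp
  map_comp_comul := by
    refine DFinsupp.lhom_ext' fun i => LinearMap.ext fun x => ?_
    simp only [LinearMap.comp_apply, DFinsupp.lsingle_apply, DFinsupp.comul_single,
      DFinsupp.lsum_single]
    rw [← LinearMap.comp_apply, ← TensorProduct.map_comp]
    refine Eq.trans ?_ (LinearMap.congr_fun (f i).map_comp_comul x)
    rw [LinearMap.comp_apply]
    congr 2 <;>
    · ext
      simp

@[simp]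
theorem CoalgHom.dfinsuppLift_single (f : ∀ i, A i →ₗc[k] C) (i : ι) (x : A i) :
    CoalgHom.dfinsuppLift f (DFinsupp.single i x) = f i x :=
  DFinsupp.lsum_single _ _ _ _

theorem isCocomm_of_surjective [Coalgebra.IsCocomm k C] (f : C →ₗc[k] D)
    (hf : Function.Surjective f) : Coalgebra.IsCocomm k D where
  comm_comp_comul := by
    ext y
    obtain ⟨x, rfl⟩ := hf y
    rw [LinearMap.comp_apply, LinearEquiv.coe_coe, ← CoalgHomClass.map_comp_comul_apply,
      ← TensorProduct.map_comm, Coalgebra.comm_comul]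

end

namespace Measuring

variable {k : Type u} [Field k] {O O' : OperadWithMul k}

namespace OperadMeasuring

/-- The measuring obtained by restriction along a coalgebra map. -/
def pullback {C D : CoCoalg k} (f : C →ₗc[k] D) (Ψ : OperadMeasuring D O O') :
    OperadMeasuring C O O' where
  map n := Ψ.map n ∘ₗ f.toLinearMap
  map_comp h i x u v := by
    refine (Ψ.map_comp h i (f x) u v).trans ?_
    rw [← CoalgHomClass.map_comp_comul_apply f x, TensorProduct.lift_compl₁₂_map]
    rfl
  map_mul x := (Ψ.map_mul (f x)).trans (by rw [CoalgHomClass.counit_comp_apply])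
  map_unit x := (Ψ.map_unit (f x)).trans (by rw [CoalgHomClass.counit_comp_apply])

/-- The measuring induced on the target of a surjective coalgebra map. -/
def descend {C D : CoCoalg k} (p : C →ₗc[k] D) (hp : Function.Surjective p)
    (Ψ : OperadMeasuring C O O') (Ω : ∀ n : ℕ, D →ₗ[k] O.carrier n →ₗ[k] O'.carrier n)
    (h : ∀ n x, Ω n (p x) = Ψ.map n x) : OperadMeasuring D O O' where
  map := Ω
  map_comp {a b r} e i y u v := by
    obtain ⟨x, rfl⟩ := hp y
    rw [h, Ψ.map_comp, ← CoalgHomClass.map_comp_comul_apply p x, TensorProduct.lift_compl₁₂_map]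
    congr 3 <;> ext z
    · exact (LinearMap.congr_fun (h a z) u).symm
    · exact (LinearMap.congr_fun (h b z) v).symm
  map_mul y := by
    obtain ⟨x, rfl⟩ := hp y
    rw [h, Ψ.map_mul, CoalgHomClass.counit_comp_apply]
  map_unit y := by
    obtain ⟨x, rfl⟩ := hp y
    rw [h, Ψ.map_unit, CoalgHomClass.counit_comp_apply]

/-- The measuring on a direct sum of coalgebras. -/
noncomputable def directSum {ι : Type u} [DecidableEq ι] {C : ι → CoCoalg k}
    (Ψ : ∀ i, OperadMeasuring (C i) O O') : OperadMeasuring ⟨Π₀ i, C i⟩ O O' where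
  map n := DFinsupp.lsum k fun i => (Ψ i).map n
  map_comp {p q r} e i x u v := by
    induction x using DFinsupp.induction_add with
    | zero => simp only [map_zero, LinearMap.zero_apply]
    | add x y hx hy => simp only [map_add, LinearMap.add_apply, hx, hy]
    | single j x =>
      rw [DFinsupp.lsum_single, (Ψ j).map_comp, DFinsupp.comul_single,
        TensorProduct.lift_compl₁₂_map]
      congr 3 <;> ext z
      · exact (LinearMap.congr_fun (DFinsupp.lsum_single k (fun i => (Ψ i).map p) j z) u).symm
      · exact (LinearMap.congr_fun (DFinsupp.lsum_single k (fun i => (Ψ i).map q) j z) v).symm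
  map_mul x := by
    induction x using DFinsupp.induction_add with
    | zero => simp only [map_zero, LinearMap.zero_apply, zero_smul]
    | add x y hx hy => simp only [map_add, LinearMap.add_apply, hx, hy, add_smul]
    | single j x => rw [DFinsupp.lsum_single, (Ψ j).map_mul, DFinsupp.counit_single]
  map_unit x := by
    induction x using DFinsupp.induction_add with
    | zero => simp only [map_zero, LinearMap.zero_apply, zero_smul]
    | add x y hx hy => simp only [map_add, LinearMap.add_apply, hx, hy, add_smul]
    | single j x => rw [DFinsupp.lsum_single, (Ψ j).map_unit, DFinsupp.counit_single]

end OperadMeasuring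

/-- The coordinate space `kⁿ` as a bare vector space, without the coalgebra structure that
`Fin n → k` carries. -/
def CoordSpace (k : Type u) [Field k] (n : ℕ) : Type u := Fin n → k

instance (n : ℕ) : AddCommGroup (CoordSpace k n) := inferInstanceAs (AddCommGroup (Fin n → k))
instance (n : ℕ) : Module k (CoordSpace k n) := inferInstanceAs (Module k (Fin n → k))

/-- A measuring by a cocommutative coalgebra structure on a coordinate space. -/
structure FiniteMeasuring (O O' : OperadWithMul k) : Type u where
  dim : ℕ
  coalgebra : Coalgebra k (CoordSpace k dim)
  isCocomm : Coalgebra.IsCocomm k (CoordSpace k dim)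
  measuring : OperadMeasuring ⟨CoordSpace k dim⟩ O O'

/-- The coalgebra of a `FiniteMeasuring`. -/
def FiniteMeasuring.coalg (F : FiniteMeasuring O O') : CoCoalg k :=
  letI := F.coalgebra
  letI := F.isCocomm
  ⟨CoordSpace k F.dim⟩

theorem FiniteMeasuring.exists_mem_range {C : CoCoalg k} (Ψ : OperadMeasuring C O O') (x : C) :
    ∃ (F : FiniteMeasuring O O') (f : F.coalg →ₗc[k] C),
      F.measuring = Ψ.pullback (C := F.coalg) f ∧ x ∈ Set.range f := by
  obtain ⟨D, hfin, hx, hD⟩ := exists_finite_subcoalgebra (k := k) x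
  let e : D ≃ₗ[k] CoordSpace k (Module.finrank k D) := (Module.finBasis k D).equivFun
  let j : CoordSpace k (Module.finrank k D) →ₗ[k] C := D.subtype ∘ₗ e.symm.toLinearMap
  have hj : Function.Injective j := D.subtype_injective.comp e.symm.injective
  have hmem (v) : Coalgebra.comul (R := k) (j v) ∈ LinearMap.range (TensorProduct.map j j) := by
    obtain ⟨w, hw⟩ := hD (j v) (e.symm v).2
    refine ⟨TensorProduct.map e.toLinearMap e.toLinearMap w, ?_⟩
    rw [← hw, ← LinearMap.comp_apply, ← TensorProduct.map_comp]
    have : j ∘ₗ e.toLinearMap = D.subtype := by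
      ext y
      simp [j]
    rw [this]
  obtain ⟨hc, f, hf⟩ := exists_coalgebra_of_injective j hj hmem
  have hcc : Coalgebra.IsCocomm k (CoordSpace k (Module.finrank k D)) :=
    isCocomm_of_injective f (by rwa [funext hf])
  exact ⟨⟨_, hc, hcc, Ψ.pullback (C := ⟨CoordSpace k (Module.finrank k D)⟩) f⟩, f, rfl, e ⟨x, hx⟩,
    (hf _).trans (by simp [j])⟩

theorem OperadMeasuring.exists_isUniversal (O O' : OperadWithMul k) :
    ∃ (M : CoCoalg k) (Φ : OperadMeasuring M O O'), Φ.IsUniversal := by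
  classical
  let P : CoCoalg k := ⟨Π₀ F : FiniteMeasuring O O', F.coalg⟩
  let ΨP : OperadMeasuring P O O' :=
    OperadMeasuring.directSum (C := FiniteMeasuring.coalg) fun F => F.measuring
  let W : Submodule k P := ⨅ n, LinearMap.ker (ΨP.map n)
  let J := W.largestCoideal
  let p : P →ₗc[k] P ⧸ J := Coalgebra.Quotient.mkQCoalgHom (R := k) J
  have hp : Function.Surjective p := Submodule.mkQ_surjective J
  have hcc : Coalgebra.IsCocomm k (P ⧸ J) := isCocomm_of_surjective p hp
  let M : CoCoalg k := ⟨P ⧸ J⟩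
  have hJ (n) : J ≤ LinearMap.ker (ΨP.map n) := W.largestCoideal_le.trans (iInf_le _ n)
  let Φ : OperadMeasuring M O O' := ΨP.descend (D := M) p hp
    (fun n => J.liftQ (ΨP.map n) (hJ n)) fun _ _ => rfl
  have hΦ (n) (x) : Φ.map n (p x) = ΨP.map n x := rfl
  have key (I : Submodule k M) (hI : I.IsCoideal) (h : ∀ y ∈ I, ∀ n, Φ.map n y = 0) : I = ⊥ := by
    refine Submodule.IsCoideal.eq_bot_of_le_map (W := W) hI fun y hy => ?_
    obtain ⟨x, rfl⟩ := hp y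
    exact ⟨x, (Submodule.mem_iInf _).2 fun n => h _ hy n, rfl⟩
  refine ⟨M, Φ, fun C Ψ => existsUnique_of_exists_of_unique ?_ ?_⟩
  · let ι := Σ F : FiniteMeasuring O O',
      {f : F.coalg →ₗc[k] C // F.measuring = Ψ.pullback (C := F.coalg) f}
    let π : (Π₀ s : ι, s.1.coalg) →ₗc[k] C := CoalgHom.dfinsuppLift fun s => s.2.1
    let q : (Π₀ s : ι, s.1.coalg) →ₗc[k] M := CoalgHom.dfinsuppLift fun s =>
      p.comp (CoalgHom.dfinsuppSingle (A := fun F : FiniteMeasuring O O' => F.coalg) s.1)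
    have hπ : Function.Surjective π := fun x => by
      obtain ⟨F, f, hF, y, hy⟩ := FiniteMeasuring.exists_mem_range Ψ x
      exact ⟨DFinsupp.single (⟨F, f, hF⟩ : ι) y, (CoalgHom.dfinsuppLift_single _ _ _).trans hy⟩
    have hq (n) (s) : Φ.map n (q s) = Ψ.map n (π s) := by
      induction s using DFinsupp.induction_add with
      | zero => simp only [map_zero]
      | add x y hx hy => simp only [map_add, hx, hy]
      | single j x =>
        rw [CoalgHom.dfinsuppLift_single, CoalgHom.dfinsuppLift_single]
        refine (hΦ n _).trans ?_
        refine (DFinsupp.lsum_single k (fun F : FiniteMeasuring O O' => F.measuring.map n)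
          j.1 x).trans ?_
        exact congrArg (fun Ω : OperadMeasuring j.1.coalg O O' => Ω.map n x) j.2.2
    have hker : LinearMap.ker π.toLinearMap ≤ LinearMap.ker q.toLinearMap := by
      have hbot := key _ (π.isCoideal_ker.map q) (by
        rintro _ ⟨s, hs, rfl⟩ n
        exact (hq n s).trans ((congrArg _ hs).trans (map_zero _)))
      intro s hs
      exact (Submodule.mem_bot k).1 (hbot ▸ Submodule.mem_map_of_mem hs)
    obtain ⟨ξ, hξ⟩ := π.exists_comp_eq_of_surjective hπ q hker
    refine ⟨ξ, fun n x => ?_⟩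
    obtain ⟨s, rfl⟩ := hπ x
    rw [hξ, hq]
  · intro f g hf hg
    have hbot := key _ (CoalgHom.isCoideal_range_sub f g) (by
      rintro _ ⟨x, rfl⟩ n
      rw [LinearMap.sub_apply, map_sub, sub_eq_zero]
      exact (hf n x).trans (hg n x).symm)
    ext x
    refine sub_eq_zero.1 ((Submodule.mem_bot k).1 ?_)
    rw [← hbot]
    exact ⟨x, rfl⟩

end Measuring

/-! ### Universal measuring comodules -/

section

variable {k C V D E : Type*} [Field k] [AddCommGroup C] [Module k C] [Coalgebra k C]
  [AddCommGroup V] [Module k V] [AddCommGroup D] [Module k D] [AddCommGroup E] [Module k E]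

variable (k C V) in
/-- The coaction of the cofree comodule `C ⊗ V`. -/
noncomputable def cofreeCoact : C ⊗[k] V →ₗ[k] C ⊗[k] (C ⊗[k] V) :=
  (TensorProduct.assoc k C C V).toLinearMap ∘ₗ
    (Coalgebra.comul (R := k) (A := C)).rTensor V

variable (k C V) in
/-- The projection `C ⊗ V → V` given by the counit. -/
noncomputable def cofreeProj : C ⊗[k] V →ₗ[k] V :=
  (TensorProduct.lid k V).toLinearMap ∘ₗ (Coalgebra.counit (R := k) (A := C)).rTensor V

theorem cofreeCoact_coassoc : TensorProduct.assoc k C C (C ⊗[k] V) ∘ₗ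
    (Coalgebra.comul (R := k) (A := C)).rTensor (C ⊗[k] V) ∘ₗ cofreeCoact k C V =
      (cofreeCoact k C V).lTensor C ∘ₗ cofreeCoact k C V := by
  refine TensorProduct.ext' fun c v => ?_
  have h := congrArg (fun z => TensorProduct.assoc k C C (C ⊗[k] V)
    (TensorProduct.assoc k (C ⊗[k] C) C V ((TensorProduct.assoc k C C C).symm z ⊗ₜ[k] v)))
    (Coalgebra.coassoc_apply (R := k) c)
  simp only [LinearEquiv.symm_apply_apply] at h
  refine Eq.trans ?_ (h.trans ?_)
  · simp only [cofreeCoact, LinearMap.comp_apply, LinearMap.rTensor_tmul]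
    hopf_tensor_induction Coalgebra.comul (R := k) c with a b
    rfl
  · simp only [cofreeCoact, LinearMap.comp_apply, LinearMap.rTensor_tmul]
    hopf_tensor_induction Coalgebra.comul (R := k) c with a b
    simp only [LinearMap.lTensor_tmul, LinearEquiv.coe_coe, TensorProduct.assoc_tmul,
      LinearMap.comp_apply, LinearMap.rTensor_tmul]
    hopf_tensor_induction Coalgebra.comul (R := k) b with b₁ b₂
    rfl

theorem cofreeCoact_counit : TensorProduct.lid k (C ⊗[k] V) ∘ₗ
    (Coalgebra.counit (R := k) (A := C)).rTensor (C ⊗[k] V) ∘ₗ cofreeCoact k C V =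
      LinearMap.id := by
  refine TensorProduct.ext' fun c v => ?_
  have h := congrArg (fun z => TensorProduct.lid k C z ⊗ₜ[k] v)
    (Coalgebra.rTensor_counit_comul (R := k) c)
  simp only [TensorProduct.lid_tmul, one_smul] at h
  refine Eq.trans ?_ h
  simp only [cofreeCoact, LinearMap.comp_apply, LinearMap.rTensor_tmul]
  hopf_tensor_induction Coalgebra.comul (R := k) c with a b
  exact TensorProduct.smul_tmul' _ _ _

theorem lTensor_cofreeProj_cofreeCoact (z : C ⊗[k] V) :
    (cofreeProj k C V).lTensor C (cofreeCoact k C V z) = z := by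
  hopf_tensor_induction z with c v
  have h := congrArg (fun z => TensorProduct.rid k C z ⊗ₜ[k] v)
    (Coalgebra.lTensor_counit_comul (R := k) c)
  simp only [TensorProduct.rid_tmul, one_smul] at h
  refine Eq.trans ?_ h
  simp only [cofreeCoact, LinearMap.comp_apply, LinearMap.rTensor_tmul]
  hopf_tensor_induction Coalgebra.comul (R := k) c with a b
  exact (TensorProduct.smul_tmul _ _ _).symm

theorem cofreeCoact_lTensor (f : D →ₗ[k] V) (ρ : D →ₗ[k] C ⊗[k] D)
    (hρ : TensorProduct.assoc k C C D ∘ₗ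
      (Coalgebra.comul (R := k) (A := C)).rTensor D ∘ₗ ρ = ρ.lTensor C ∘ₗ ρ) :
    cofreeCoact k C V ∘ₗ (f.lTensor C ∘ₗ ρ) = (f.lTensor C ∘ₗ ρ).lTensor C ∘ₗ ρ := by
  ext y
  have h := congrArg (LinearMap.lTensor C (f.lTensor C)) (LinearMap.congr_fun hρ y)
  simp only [LinearMap.comp_apply] at h
  rw [LinearMap.lTensor_comp]
  refine Eq.trans ?_ h
  simp only [cofreeCoact, LinearMap.comp_apply]
  generalize ρ y = w
  hopf_tensor_induction w with c d
  simp only [LinearMap.lTensor_tmul, LinearMap.rTensor_tmul]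
  hopf_tensor_induction Coalgebra.comul (R := k) c with a b
  rfl

theorem cofreeProj_lTensor (f : D →ₗ[k] V) (ρ : D →ₗ[k] C ⊗[k] D)
    (hρ : TensorProduct.lid k D ∘ₗ
      (Coalgebra.counit (R := k) (A := C)).rTensor D ∘ₗ ρ = LinearMap.id) (y : D) :
    cofreeProj k C V (f.lTensor C (ρ y)) = f y := by
  refine Eq.trans ?_ (congrArg f (LinearMap.congr_fun hρ y))
  simp only [cofreeProj, LinearMap.comp_apply]
  generalize ρ y = w
  hopf_tensor_induction w with c d
  exact (map_smul f _ _).symm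

theorem coassoc_of_injective (j : D →ₗ[k] E) (hj : Function.Injective j)
    (σ : D →ₗ[k] C ⊗[k] D) (ρ : E →ₗ[k] C ⊗[k] E) (h : ∀ y, j.lTensor C (σ y) = ρ (j y))
    (hρ : TensorProduct.assoc k C C E ∘ₗ
      (Coalgebra.comul (R := k) (A := C)).rTensor E ∘ₗ ρ = ρ.lTensor C ∘ₗ ρ) :
    TensorProduct.assoc k C C D ∘ₗ
      (Coalgebra.comul (R := k) (A := C)).rTensor D ∘ₗ σ = σ.lTensor C ∘ₗ σ := by
  ext y
  apply Module.Flat.lTensor_preserves_injective_linearMap (M := C) _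
    (Module.Flat.lTensor_preserves_injective_linearMap (M := C) j hj)
  have hy := LinearMap.congr_fun hρ (j y)
  simp only [LinearMap.comp_apply, ← h] at hy ⊢
  refine Eq.trans ?_ (hy.trans ?_)
  · generalize σ y = w
    hopf_tensor_induction w with c d
    simp only [LinearMap.lTensor_tmul, LinearMap.rTensor_tmul]
    hopf_tensor_induction Coalgebra.comul (R := k) c with a b
    rfl
  · generalize σ y = w
    hopf_tensor_induction w with c d
    exact congrArg (fun z => c ⊗ₜ[k] z) (h d).symm

theorem counit_of_injective (j : D →ₗ[k] E) (hj : Function.Injective j)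
    (σ : D →ₗ[k] C ⊗[k] D) (ρ : E →ₗ[k] C ⊗[k] E) (h : ∀ y, j.lTensor C (σ y) = ρ (j y))
    (hρ : TensorProduct.lid k E ∘ₗ
      (Coalgebra.counit (R := k) (A := C)).rTensor E ∘ₗ ρ = LinearMap.id) :
    TensorProduct.lid k D ∘ₗ
      (Coalgebra.counit (R := k) (A := C)).rTensor D ∘ₗ σ = LinearMap.id := by
  ext y
  apply hj
  refine Eq.trans ?_ (LinearMap.congr_fun hρ (j y))
  simp only [LinearMap.comp_apply, ← h]
  generalize σ y = w
  hopf_tensor_induction w with c d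
  exact map_smul j _ _

end

namespace Measuring

variable {k : Type u} [Field k]

namespace Comodule

variable {C : CoCoalg k}

/-- The cofree comodule `C ⊗ V`. -/
noncomputable def cofree (C : CoCoalg k) (V : Type u) [AddCommGroup V] [Module k V] :
    Comodule C where
  carrier := C ⊗[k] V
  coact := cofreeCoact k C V
  coassoc := cofreeCoact_coassoc
  counit_coact := cofreeCoact_counit

/-- A subspace is a subcomodule if the coaction maps it into `C ⊗ I`. -/
def IsSubcomodule (D : Comodule C) (I : Submodule k D) : Prop :=
  ∀ y ∈ I, D.coact y ∈ LinearMap.range (I.subtype.lTensor C)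

theorem isSubcomodule_sSup (D : Comodule C) (S : Set (Submodule k D))
    (hS : ∀ I ∈ S, D.IsSubcomodule I) : D.IsSubcomodule (sSup S) := by
  have : sSup S ≤ (LinearMap.range ((sSup S).subtype.lTensor C)).comap D.coact := by
    refine sSup_le fun I hI y hy => ?_
    obtain ⟨w, hw⟩ := hS I hI y hy
    refine ⟨(Submodule.inclusion (le_sSup hI)).lTensor C w, ?_⟩
    rw [← hw, ← LinearMap.comp_apply, ← LinearMap.lTensor_comp, Submodule.subtype_comp_inclusion]
  exact fun y hy => this hy

/-- The largest subcomodule contained in a subspace. -/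
def largestSubcomodule (D : Comodule C) (W : Submodule k D) : Submodule k D :=
  sSup {I | D.IsSubcomodule I ∧ I ≤ W}

theorem isSubcomodule_largestSubcomodule (D : Comodule C) (W : Submodule k D) :
    D.IsSubcomodule (D.largestSubcomodule W) :=
  D.isSubcomodule_sSup _ fun _ h => h.1

theorem largestSubcomodule_le (D : Comodule C) (W : Submodule k D) :
    D.largestSubcomodule W ≤ W :=
  sSup_le fun _ h => h.2

theorem IsSubcomodule.le_largestSubcomodule {D : Comodule C} {I W : Submodule k D}
    (hI : D.IsSubcomodule I) (h : I ≤ W) : I ≤ D.largestSubcomodule W :=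
  le_sSup ⟨hI, h⟩

theorem _root_.Measuring.ComoduleHom.isSubcomodule_range {D E : Comodule C} (f : ComoduleHom D E) :
    E.IsSubcomodule (LinearMap.range f.toLinearMap) := by
  rintro _ ⟨y, rfl⟩
  refine ⟨f.toLinearMap.rangeRestrict.lTensor C (D.coact y), ?_⟩
  rw [← LinearMap.comp_apply, ← LinearMap.lTensor_comp]
  exact (LinearMap.congr_fun f.coact_comp y).symm

theorem IsSubcomodule.exists_coact {E : Comodule C} {I : Submodule k E} (hI : E.IsSubcomodule I) :
    ∃ σ : I →ₗ[k] C ⊗[k] I, ∀ y, I.subtype.lTensor C (σ y) = E.coact y :=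
  LinearMap.exists_comp_eq_of_injective _
    (Module.Flat.lTensor_preserves_injective_linearMap (M := C) _ I.subtype_injective)
    (E.coact ∘ₗ I.subtype) fun y => hI y y.2

/-- A subcomodule, as a comodule. -/
noncomputable def ofIsSubcomodule {E : Comodule C} {I : Submodule k E} (hI : E.IsSubcomodule I) :
    Comodule C where
  carrier := I
  coact := hI.exists_coact.choose
  coassoc := coassoc_of_injective I.subtype I.subtype_injective _ _ hI.exists_coact.choose_spec
    E.coassoc
  counit_coact := counit_of_injective I.subtype I.subtype_injective _ _
    hI.exists_coact.choose_spec E.counit_coact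

theorem lTensor_subtype_coact {E : Comodule C} {I : Submodule k E} (hI : E.IsSubcomodule I)
    (y : I) : I.subtype.lTensor C ((ofIsSubcomodule hI).coact y) = E.coact y :=
  hI.exists_coact.choose_spec y

end Comodule

namespace ComoduleMeasuring

variable {C : CoCoalg k} {O O' : OperadWithMul k}

/-- The elements `z` of a comodule on which a family of linear maps `Ω` satisfies the conditions
that define comodule measurings. -/
def conditions (Ψ : OperadMeasuring C O O') (E : Comodule C) (L : CyclicCompModule O)
    (L' : CyclicCompModule O') (Ω : ∀ n : ℕ, E →ₗ[k] L.carrier n →ₗ[k] L'.carrier n) :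
    Submodule k E where
  carrier := {z | (∀ {p n r : ℕ} (h : r + p = n + 1) (i : ℕ), i ≤ r → ∀ (u : O.carrier p)
      (l : L.carrier n), Ω r z (L.act h i u l) =
        TensorProduct.lift ((L'.act h i).compl₁₂ ((Ψ.map p).flip u) ((Ω n).flip l)) (E.coact z)) ∧
    ∀ (n : ℕ) (l : L.carrier (n + 1)), Ω (n + 1) z (L.cyc n l) = L'.cyc n (Ω (n + 1) z l)}
  add_mem' {x y} hx hy := by
    refine ⟨fun h i hi u l => ?_, fun n l => ?_⟩
    · rw [map_add, map_add, map_add, LinearMap.add_apply, hx.1 h i hi, hy.1 h i hi]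
    · rw [map_add, LinearMap.add_apply, LinearMap.add_apply, map_add, hx.2, hy.2]
  zero_mem' := by
    refine ⟨fun h i hi u l => ?_, fun n l => ?_⟩
    · rw [map_zero, map_zero, map_zero, LinearMap.zero_apply]
    · rw [map_zero, LinearMap.zero_apply, LinearMap.zero_apply, map_zero]
  smul_mem' c x hx := by
    refine ⟨fun h i hi u l => ?_, fun n l => ?_⟩
    · rw [map_smul, map_smul, map_smul, LinearMap.smul_apply, hx.1 h i hi]
    · rw [map_smul, LinearMap.smul_apply, LinearMap.smul_apply, map_smul, hx.2]

theorem exists_isUniversal (Ψ : OperadMeasuring C O O') (L : CyclicCompModule O)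
    (L' : CyclicCompModule O') :
    ∃ (Q : Comodule C) (Θ : ComoduleMeasuring Ψ Q L L'), Θ.IsUniversal := by
  let V := ∀ n : ℕ, L.carrier n →ₗ[k] L'.carrier n
  let E : Comodule C := Comodule.cofree C V
  let π : E →ₗ[k] V := cofreeProj k C V
  let ΩE (n : ℕ) : E →ₗ[k] L.carrier n →ₗ[k] L'.carrier n := LinearMap.proj n ∘ₗ π
  let W := conditions Ψ E L L' ΩE
  let I := E.largestSubcomodule W
  have hI : E.IsSubcomodule I := E.isSubcomodule_largestSubcomodule W
  have hIW : I ≤ W := E.largestSubcomodule_le W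
  let Q : Comodule C := Comodule.ofIsSubcomodule hI
  let j : Q →ₗ[k] E := I.subtype
  have hjinj : Function.Injective j := I.subtype_injective
  have hj (y : Q) : j.lTensor C (Q.coact y) = E.coact (j y) := Comodule.lTensor_subtype_coact hI y
  have hjC : Function.Injective (j.lTensor C) :=
    Module.Flat.lTensor_preserves_injective_linearMap (M := C) _ hjinj
  let Θ : ComoduleMeasuring Ψ Q L L' :=
    { map := fun n => ΩE n ∘ₗ j
      map_act := fun {p n r} h i hi y u l => by
        refine ((hIW y.2).1 h i hi u l).trans ?_
        refine (congrArg _ (hj y).symm).trans ?_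
        exact TensorProduct.lift_compl₁₂_map _ _ _ LinearMap.id j (Q.coact y)
      map_cyc := fun n y l => (hIW y.2).2 n l }
  refine ⟨Q, Θ, fun D Ω => existsUnique_of_exists_of_unique ?_ ?_⟩
  · let f : D →ₗ[k] V := LinearMap.pi Ω.map
    let φ : ComoduleHom D E := ⟨f.lTensor C ∘ₗ D.coact, cofreeCoact_lTensor f D.coact D.coassoc⟩
    have hφ (n) (y) : ΩE n (φ.toLinearMap y) = Ω.map n y :=
      congrFun (cofreeProj_lTensor f D.coact D.counit_coact y) n
    have hφc (y) : E.coact (φ.toLinearMap y) = φ.toLinearMap.lTensor C (D.coact y) :=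
      LinearMap.congr_fun φ.coact_comp y
    have hmem (y) : φ.toLinearMap y ∈ I := by
      refine φ.isSubcomodule_range.le_largestSubcomodule ?_ ⟨y, rfl⟩
      rintro _ ⟨y, rfl⟩
      refine ⟨fun {p n r} h i hi u l => ?_, fun n l => ?_⟩
      · rw [hφ, Ω.map_act h i hi, hφc]
        refine Eq.trans ?_
          (TensorProduct.lift_compl₁₂_map _ _ _ LinearMap.id φ.toLinearMap (D.coact y)).symm
        congr 3
        ext z
        exact (LinearMap.congr_fun (hφ n z) l).symm
      · rw [hφ, Ω.map_cyc]
    let χ : D →ₗ[k] Q := φ.toLinearMap.codRestrict I hmem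
    have hχ (y) : j (χ y) = φ.toLinearMap y := rfl
    refine ⟨⟨χ, ?_⟩, fun n y => hφ n y⟩
    ext y
    apply hjC
    rw [LinearMap.comp_apply, hj, hχ, hφc, LinearMap.comp_apply]
    exact LinearMap.congr_fun (LinearMap.lTensor_comp C j χ) (D.coact y)
  · have key (χ : ComoduleHom D Q) (y : D) :
        j (χ.toLinearMap y) = (π ∘ₗ j ∘ₗ χ.toLinearMap).lTensor C (D.coact y) := by
      refine (lTensor_cofreeProj_cofreeCoact (k := k) (C := C) (V := V) _).symm.trans ?_
      have h1 : cofreeCoact k C V (j (χ.toLinearMap y)) = j.lTensor C (Q.coact (χ.toLinearMap y)) :=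
        (hj _).symm
      have h2 : Q.coact (χ.toLinearMap y) = χ.toLinearMap.lTensor C (D.coact y) :=
        LinearMap.congr_fun χ.coact_comp y
      rw [h1, h2, LinearMap.lTensor_comp, LinearMap.lTensor_comp]
      rfl
    intro χ χ' h h'
    have hlin : π ∘ₗ j ∘ₗ χ.toLinearMap = π ∘ₗ j ∘ₗ χ'.toLinearMap := by
      ext1 y
      exact funext fun n => (h n y).trans (h' n y).symm
    have : χ.toLinearMap = χ'.toLinearMap := by
      ext y
      apply hjinj
      rw [key, key, hlin]
    cases χ
    cases χ'
    congr

end ComoduleMeasuring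

end Measuring

/-! ### Enrichment of operads over cocommutative coalgebras -/

namespace Measuring

variable {k : Type u} [Field k]

namespace OperadMeasuring

variable {O O' O'' : OperadWithMul k}

/-- The measuring of an operad to itself by scalar multiples of the identity maps. -/
noncomputable def id (O : OperadWithMul k) : OperadMeasuring (𝟙_ (CoCoalg k)) O O where
  map n := LinearMap.toSpanSingleton k (O.carrier n →ₗ[k] O.carrier n) LinearMap.id
  map_comp {p q r} h i c u v := by
    change k at c
    change c • O.comp h i u v = O.comp h i ((1 : k) • u) (c • v)
    rw [one_smul, map_smul]
  map_mul _ := rfl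
  map_unit _ := rfl

/-- The measuring `x ⊗ x' ↦ Ψ' x' ∘ Ψ x`. -/
noncomputable def comp {C C' : CoCoalg k} (Ψ : OperadMeasuring C O O')
    (Ψ' : OperadMeasuring C' O' O'') : OperadMeasuring (C ⊗ C') O O'' where
  map n := TensorProduct.lift
    ((LinearMap.llcomp k (O.carrier n) (O'.carrier n) (O''.carrier n)).flip.compl₁₂
      (Ψ.map n) (Ψ'.map n))
  map_comp {p q r} h i w u v := by
    change C ⊗[k] C' at w
    induction w with
    | zero => simp only [map_zero, LinearMap.zero_apply]
    | add x y hx hy => simp only [map_add, LinearMap.add_apply, hx, hy]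
    | tmul x x' =>
      change Ψ'.map r x' (Ψ.map r x (O.comp h i u v)) = TensorProduct.lift _
        (TensorProduct.tensorTensorTensorComm k C C C' C'
          (Coalgebra.comul (R := k) x ⊗ₜ[k] Coalgebra.comul (R := k) x'))
      rw [Ψ.map_comp]
      hopf_tensor_induction Coalgebra.comul (R := k) x with a b
      refine (Ψ'.map_comp h i x' (Ψ.map p a u) (Ψ.map q b v)).trans ?_
      hopf_tensor_induction Coalgebra.comul (R := k) x' with a' b'
      rfl
  map_mul w := by
    change C ⊗[k] C' at w
    induction w with
    | zero => simp only [map_zero, LinearMap.zero_apply, zero_smul]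
    | add x y hx hy => simp only [map_add, LinearMap.add_apply, hx, hy, add_smul]
    | tmul x x' =>
      change Ψ'.map 2 x' (Ψ.map 2 x O.mul) =
        (Coalgebra.counit (R := k) x' • Coalgebra.counit (R := k) x) • O''.mul
      rw [Ψ.map_mul, map_smul, Ψ'.map_mul, smul_smul, smul_eq_mul, mul_comm]
  map_unit w := by
    change C ⊗[k] C' at w
    induction w with
    | zero => simp only [map_zero, LinearMap.zero_apply, zero_smul]
    | add x y hx hy => simp only [map_add, LinearMap.add_apply, hx, hy, add_smul]
    | tmul x x' =>
      change Ψ'.map 0 x' (Ψ.map 0 x O.unit) =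
        (Coalgebra.counit (R := k) x' • Coalgebra.counit (R := k) x) • O''.unit
      rw [Ψ.map_unit, map_smul, Ψ'.map_unit, smul_smul, smul_eq_mul, mul_comm]

theorem IsUniversal.hom_ext {M C : CoCoalg k} {Φ : OperadMeasuring M O O'} (hΦ : Φ.IsUniversal)
    {f g : C ⟶ M} (h : ∀ n, Φ.map n ∘ₗ (CoCoalg.Hom.toCoalgHom f).toLinearMap =
      Φ.map n ∘ₗ (CoCoalg.Hom.toCoalgHom g).toLinearMap) : f = g :=
  (hΦ C (Φ.pullback f)).unique (fun _ _ => rfl) fun n x => (LinearMap.congr_fun (h n) x).symm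

end OperadMeasuring

theorem Enrichment.ext_of_eq {V : Type*} [Category V] [MonoidalCategory V] {ι : Type*}
    {H : ι → ι → V} {S T : Enrichment H} (h₁ : ∀ X, S.id X = T.id X)
    (h₂ : ∀ X Y Z, S.comp X Y Z = T.comp X Y Z) : S = T := by
  obtain ⟨i, c, _, _, _⟩ := S
  obtain ⟨i', c', _, _, _⟩ := T
  obtain rfl : i = i' := funext h₁
  obtain rfl : c = c' := funext fun X => funext fun Y => funext fun Z => h₂ X Y Z
  rfl

section Operads

variable {M : OperadWithMul k → OperadWithMul k → CoCoalg k}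
  {Φ : ∀ O O', OperadMeasuring (M O O') O O'}

theorem exists_inducedByOperads (hΦ : ∀ O O', (Φ O O').IsUniversal) :
    ∃ S : Enrichment M, S.InducedByOperads Φ := by
  choose i hi _ using fun O => hΦ O O _ (OperadMeasuring.id O)
  choose c hc _ using fun O O' O'' => hΦ O O'' _ ((Φ O O').comp (Φ O' O''))
  have hi' (O) (n) (a : k) : (Φ O O).map n (i O a) = a • LinearMap.id := hi O n a
  have hc' (O O' O'') (n) (x : M O O') (x' : M O' O'') :
      (Φ O O'').map n (c O O' O'' (x ⊗ₜ[k] x')) = (Φ O' O'').map n x' ∘ₗ (Φ O O').map n x :=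
    hc O O' O'' n (x ⊗ₜ[k] x')
  refine ⟨⟨i, c, fun X Y => ?_, fun X Y => ?_, fun W X Y Z => ?_⟩, hi', hc'⟩
  · refine (hΦ X Y).hom_ext fun n => LinearMap.ext fun x => ?_
    change (Φ X Y).map n (c X X Y (i X (1 : k) ⊗ₜ[k] x)) = (Φ X Y).map n x
    rw [hc', hi', one_smul, LinearMap.comp_id]
  · refine (hΦ X Y).hom_ext fun n => LinearMap.ext fun x => ?_
    change (Φ X Y).map n (c X Y Y (x ⊗ₜ[k] i Y (1 : k))) = (Φ X Y).map n x
    rw [hc', hi', one_smul, LinearMap.id_comp]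
  · refine (hΦ W Z).hom_ext fun n => TensorProduct.ext <| LinearMap.ext fun x =>
      TensorProduct.ext' fun y z => ?_
    change (Φ W Z).map n (c W Y Z (c W X Y (x ⊗ₜ[k] y) ⊗ₜ[k] z)) =
      (Φ W Z).map n (c W X Z (x ⊗ₜ[k] c X Y Z (y ⊗ₜ[k] z)))
    rw [hc', hc', hc', hc', LinearMap.comp_assoc]

theorem Enrichment.InducedByOperads.eq (hΦ : ∀ O O', (Φ O O').IsUniversal) {S S' : Enrichment M}
    (hS : S.InducedByOperads Φ) (hS' : S'.InducedByOperads Φ) : S' = S := by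
  refine Enrichment.ext_of_eq (fun X => ?_) fun X Y Z => ?_
  · exact (hΦ X X).hom_ext fun n => LinearMap.ext fun c => (hS'.id X n c).trans (hS.id X n c).symm
  · exact (hΦ X Z).hom_ext fun n => TensorProduct.ext' fun x y =>
      (hS'.comp X Y Z n x y).trans (hS.comp X Y Z n x y).symm

end Operads

end Measuring

/-! ### Enrichment of pairs over comodules -/

namespace Measuring

variable {k : Type u} [Field k]

/-- Corestriction of a comodule along a coalgebra map. -/
noncomputable def Comodule.corestrict {C C' : CoCoalg k} (f : C →ₗc[k] C') (D : Comodule C) :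
    Comodule C' where
  carrier := D
  coact := f.toLinearMap.rTensor D ∘ₗ D.coact
  coassoc := by
    ext y
    have h := congrArg (TensorProduct.map f.toLinearMap (f.toLinearMap.rTensor D))
      (LinearMap.congr_fun D.coassoc y)
    simp only [LinearMap.comp_apply] at h ⊢
    refine Eq.trans ?_ (h.trans ?_)
    · generalize D.coact y = w
      hopf_tensor_induction w with c d
      simp only [LinearMap.rTensor_tmul]
      have hc := LinearMap.congr_fun f.map_comp_comul c
      simp only [LinearMap.comp_apply] at hc
      rw [← hc]
      hopf_tensor_induction Coalgebra.comul (R := k) c with a b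
      rfl
    · generalize D.coact y = w
      hopf_tensor_induction w with c d
      rfl
  counit_coact := by
    ext y
    refine Eq.trans ?_ (LinearMap.congr_fun D.counit_coact y)
    simp only [LinearMap.comp_apply]
    generalize D.coact y = w
    hopf_tensor_induction w with c d
    exact congrArg (fun a => a • d) (CoalgHomClass.counit_comp_apply f c)

namespace ComoduleMeasuring

variable {O O' O'' : OperadWithMul k} {L : CyclicCompModule O} {L' : CyclicCompModule O'}
  {L'' : CyclicCompModule O''}

/-- Restriction of a comodule measuring along a map of comodules. -/
def pullback {C : CoCoalg k} {Ψ : OperadMeasuring C O O'} {D E : Comodule C}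
    (χ : ComoduleHom D E) (Ω : ComoduleMeasuring Ψ E L L') : ComoduleMeasuring Ψ D L L' where
  map n := Ω.map n ∘ₗ χ.toLinearMap
  map_act h i hi y u l := by
    refine (Ω.map_act h i hi (χ.toLinearMap y) u l).trans ?_
    refine (congrArg _ (LinearMap.congr_fun χ.coact_comp y)).trans ?_
    exact TensorProduct.lift_compl₁₂_map _ _ _ LinearMap.id χ.toLinearMap (D.coact y)
  map_cyc n y l := Ω.map_cyc n (χ.toLinearMap y) l

/-- A comodule measuring over a measuring that factors through a coalgebra map is a comodule
measuring on the corestriction. -/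
def corestrict {C C' : CoCoalg k} {Ψ : OperadMeasuring C O O'} {Ψ' : OperadMeasuring C' O O'}
    (f : C →ₗc[k] C') (hf : ∀ n x, Ψ'.map n (f x) = Ψ.map n x) {D : Comodule C}
    (Ω : ComoduleMeasuring Ψ D L L') : ComoduleMeasuring Ψ' (D.corestrict f) L L' where
  map := Ω.map
  map_act {p n r} h i hi y u l := by
    refine (Ω.map_act h i hi y u l).trans ?_
    refine Eq.trans ?_
      (TensorProduct.lift_compl₁₂_map _ _ _ f.toLinearMap LinearMap.id (D.coact y)).symm
    congr 3
    ext z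
    exact (LinearMap.congr_fun (hf p z) u).symm
  map_cyc := Ω.map_cyc

/-- The measuring of a module to itself by scalar multiples of the identity maps. -/
noncomputable def id (L : CyclicCompModule O) :
    ComoduleMeasuring (OperadMeasuring.id O) (Comod.unitComodule (k := k)) L L where
  map n := LinearMap.toSpanSingleton k (L.carrier n →ₗ[k] L.carrier n) LinearMap.id
  map_act {p n r} h i _ c u l := by
    change k at c
    change c • L.act h i u l = L.act h i ((1 : k) • u) (c • l)
    rw [one_smul, map_smul]
  map_cyc n c l := ((L.cyc n).map_smul _ _).symm

/-- The comodule measuring `y ⊗ y' ↦ Ω' y' ∘ Ω y`. -/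
noncomputable def comp {C C' : CoCoalg k} {Ψ : OperadMeasuring C O O'}
    {Ψ' : OperadMeasuring C' O' O''} {D : Comodule C} {D' : Comodule C'}
    (Ω : ComoduleMeasuring Ψ D L L') (Ω' : ComoduleMeasuring Ψ' D' L' L'') :
    ComoduleMeasuring (Ψ.comp Ψ') (Comod.tensorComodule D D') L L'' where
  map n := TensorProduct.lift
    ((LinearMap.llcomp k (L.carrier n) (L'.carrier n) (L''.carrier n)).flip.compl₁₂
      (Ω.map n) (Ω'.map n))
  map_act {p n r} h i hi w u l := by
    let β (n : ℕ) : D ⊗[k] D' →ₗ[k] L.carrier n →ₗ[k] L''.carrier n := TensorProduct.lift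
      ((LinearMap.llcomp k (L.carrier n) (L'.carrier n) (L''.carrier n)).flip.compl₁₂
        (Ω.map n) (Ω'.map n))
    refine LinearMap.congr_fun (TensorProduct.ext' (g := (β r).flip (L.act h i u l))
      (h := TensorProduct.lift ((L''.act h i).compl₁₂ (((Ψ.comp Ψ').map p).flip u)
        ((β n).flip l)) ∘ₗ tensorCoact D.coact D'.coact) fun y y' => ?_) w
    change Ω'.map r y' (Ω.map r y (L.act h i u l)) = TensorProduct.lift _
      (TensorProduct.tensorTensorTensorComm k C D C' D' (D.coact y ⊗ₜ[k] D'.coact y'))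
    rw [Ω.map_act h i hi]
    hopf_tensor_induction D.coact y with a b
    refine (Ω'.map_act h i hi y' (Ψ.map p a u) (Ω.map n b l)).trans ?_
    hopf_tensor_induction D'.coact y' with a' b'
    rfl
  map_cyc n w l := by
    let β : D ⊗[k] D' →ₗ[k] L.carrier (n + 1) →ₗ[k] L''.carrier (n + 1) := TensorProduct.lift
      ((LinearMap.llcomp k (L.carrier (n + 1)) (L'.carrier (n + 1))
        (L''.carrier (n + 1))).flip.compl₁₂ (Ω.map (n + 1)) (Ω'.map (n + 1)))
    refine LinearMap.congr_fun (TensorProduct.ext' (g := β.flip (L.cyc n l))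
      (h := L''.cyc n ∘ₗ β.flip l) fun y y' => ?_) w
    change Ω'.map (n + 1) y' (Ω.map (n + 1) y (L.cyc n l)) =
      L''.cyc n (Ω'.map (n + 1) y' (Ω.map (n + 1) y l))
    rw [Ω.map_cyc, Ω'.map_cyc]

variable {M : CoCoalg k} {Φ : OperadMeasuring M O O'} {Q : Comodule M}
  {Θ : ComoduleMeasuring Φ Q L L'}

theorem IsUniversal.exists_hom (hΘ : Θ.IsUniversal) {X : Comod k} (f : X.coalg ⟶ M)
    {Ψ : OperadMeasuring X.coalg O O'}
    (hf : ∀ n x, Φ.map n (CoCoalg.Hom.toCoalgHom f x) = Ψ.map n x)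
    (Ω : ComoduleMeasuring Ψ X.comod L L') :
    ∃ g : X ⟶ (⟨M, Q⟩ : Comod k), g.coalg = f ∧ ∀ n y, Θ.map n (g.comod y) = Ω.map n y := by
  obtain ⟨χ, hχ, _⟩ := hΘ _ (Ω.corestrict f hf)
  exact ⟨⟨f, χ.toLinearMap, χ.coact_comp⟩, rfl, hχ⟩

theorem IsUniversal.hom_ext (hΘ : Θ.IsUniversal) {X : Comod k} {f g : X ⟶ (⟨M, Q⟩ : Comod k)}
    (h : f.coalg = g.coalg) (hm : ∀ n, Θ.map n ∘ₗ f.comod = Θ.map n ∘ₗ g.comod) : f = g := by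
  obtain ⟨φ, a, ha⟩ := f
  obtain ⟨ψ, b, hb⟩ := g
  obtain rfl : φ = ψ := h
  let α : ComoduleHom (X.comod.corestrict (CoCoalg.Hom.toCoalgHom φ)) Q := ⟨a, ha⟩
  let β : ComoduleHom (X.comod.corestrict (CoCoalg.Hom.toCoalgHom φ)) Q := ⟨b, hb⟩
  have : α = β := (hΘ _ (Θ.pullback α)).unique (fun _ _ => rfl)
    fun n y => (LinearMap.congr_fun (hm n) y).symm
  obtain rfl : a = b := congrArg ComoduleHom.toLinearMap this
  rfl

end ComoduleMeasuring

section Pairs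

variable {M : OperadWithMul k → OperadWithMul k → CoCoalg k}
  {Φ : ∀ O O', OperadMeasuring (M O O') O O'}
  {Q : ∀ X Y : CompPair k, Comodule (M X.operad Y.operad)}
  {Θ : ∀ X Y, ComoduleMeasuring (Φ X.operad Y.operad) (Q X Y) X.mod Y.mod}

theorem exists_inducedByPairs {S : Enrichment M} (hS : S.InducedByOperads Φ)
    (hΘ : ∀ X Y, (Θ X Y).IsUniversal) :
    ∃ T : Enrichment (V := Comod k) fun X Y : CompPair k => ⟨M X.operad Y.operad, Q X Y⟩,
      T.InducedByPairs S Θ := by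
  let H (X Y : CompPair k) : Comod k := ⟨M X.operad Y.operad, Q X Y⟩
  have hid (X : CompPair k) : ∃ g : 𝟙_ (Comod k) ⟶ H X X, g.coalg = S.id X.operad ∧
      ∀ (n : ℕ) (a : k), (Θ X X).map n (g.comod a) = a • LinearMap.id :=
    (hΘ X X).exists_hom (X := 𝟙_ (Comod k)) (S.id X.operad)
      (Ψ := OperadMeasuring.id X.operad) (fun n a => hS.id X.operad n a)
      (ComoduleMeasuring.id X.mod)
  have hcomp (X Y Z : CompPair k) : ∃ g : H X Y ⊗ H Y Z ⟶ H X Z,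
      g.coalg = S.comp X.operad Y.operad Z.operad ∧
      ∀ (n : ℕ) (y : Q X Y) (y' : Q Y Z),
        (Θ X Z).map n (g.comod (y ⊗ₜ[k] y')) = (Θ Y Z).map n y' ∘ₗ (Θ X Y).map n y := by
    obtain ⟨g, hg, h⟩ := (hΘ X Z).exists_hom (X := H X Y ⊗ H Y Z)
      (S.comp X.operad Y.operad Z.operad)
      (Ψ := (Φ X.operad Y.operad).comp (Φ Y.operad Z.operad))
      (fun n w => LinearMap.congr_fun (TensorProduct.ext'
        (g := (Φ X.operad Z.operad).map n ∘ₗ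
          (CoCoalg.Hom.toCoalgHom (S.comp X.operad Y.operad Z.operad)).toLinearMap)
        (h := ((Φ X.operad Y.operad).comp (Φ Y.operad Z.operad)).map n)
        fun x x' => hS.comp X.operad Y.operad Z.operad n x x') w)
      ((Θ X Y).comp (Θ Y Z))
    exact ⟨g, hg, fun n y y' => h n (y ⊗ₜ[k] y')⟩
  choose i hi₁ hi₂ using hid
  choose c hc₁ hc₂ using hcomp
  refine ⟨⟨i, c, fun X Y => ?_, fun X Y => ?_, fun W X Y Z => ?_⟩, hi₁, hc₁, hi₂, hc₂⟩
  · refine (hΘ X Y).hom_ext ?_ fun n => LinearMap.ext fun y => ?_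
    · change (λ_ (M X.operad Y.operad)).inv ≫ (i X).coalg ▷ _ ≫ (c X X Y).coalg = 𝟙 _
      rw [hi₁, hc₁]
      exact S.id_comp _ _
    · change (Θ X Y).map n ((c X X Y).comod ((i X).comod (1 : k) ⊗ₜ[k] y)) = (Θ X Y).map n y
      rw [hc₂, hi₂, one_smul, LinearMap.comp_id]
  · refine (hΘ X Y).hom_ext ?_ fun n => LinearMap.ext fun y => ?_
    · change (ρ_ (M X.operad Y.operad)).inv ≫ _ ◁ (i Y).coalg ≫ (c X Y Y).coalg = 𝟙 _
      rw [hi₁, hc₁]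
      exact S.comp_id _ _
    · change (Θ X Y).map n ((c X Y Y).comod (y ⊗ₜ[k] (i Y).comod (1 : k))) = (Θ X Y).map n y
      rw [hc₂, hi₂, one_smul, LinearMap.id_comp]
  · refine (hΘ W Z).hom_ext ?_ fun n => TensorProduct.ext <| LinearMap.ext fun x =>
      TensorProduct.ext' fun y z => ?_
    · change (α_ _ _ _).inv ≫ (c W X Y).coalg ▷ _ ≫ (c W Y Z).coalg =
        _ ◁ (c X Y Z).coalg ≫ (c W X Z).coalg
      rw [hc₁, hc₁, hc₁, hc₁]
      exact S.assoc _ _ _ _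
    · change (Θ W Z).map n ((c W Y Z).comod ((c W X Y).comod (x ⊗ₜ[k] y) ⊗ₜ[k] z)) =
        (Θ W Z).map n ((c W X Z).comod (x ⊗ₜ[k] (c X Y Z).comod (y ⊗ₜ[k] z)))
      rw [hc₂, hc₂, hc₂, hc₂, LinearMap.comp_assoc]

theorem Enrichment.InducedByPairs.eq (hΘ : ∀ X Y, (Θ X Y).IsUniversal) {S : Enrichment M}
    {T T' : Enrichment (V := Comod k) fun X Y : CompPair k => ⟨M X.operad Y.operad, Q X Y⟩}
    (hT : T.InducedByPairs S Θ) (hT' : T'.InducedByPairs S Θ) : T' = T := by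
  refine Enrichment.ext_of_eq (fun X => ?_) fun X Y Z => ?_
  · exact (hΘ X X).hom_ext ((hT'.id_coalg X).trans (hT.id_coalg X).symm) fun n =>
      LinearMap.ext fun c => (hT'.id_comod X n c).trans (hT.id_comod X n c).symm
  · exact (hΘ X Z).hom_ext ((hT'.comp_coalg X Y Z).trans (hT.comp_coalg X Y Z).symm) fun n =>
      TensorProduct.ext' fun x y =>
        (hT'.comp_comod X Y Z n x y).trans (hT.comp_comod X Y Z n x y).symm

end Pairs

end Measuring

theorem mainTheorem11 (k : Type u) [Field k] :
    -- universal cocommutative measuring coalgebras exist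
    (∀ O O' : OperadWithMul k,
      ∃ (M : CoCoalg k) (Φ : OperadMeasuring M O O'), Φ.IsUniversal) ∧
    -- universal measuring comodules exist
    (∀ (C : CoCoalg k) (O O' : OperadWithMul k)
      (Ψ : OperadMeasuring C O O')
      (L : CyclicCompModule O) (L' : CyclicCompModule O'),
      ∃ (Q : Comodule C) (Θ : ComoduleMeasuring Ψ Q L L'), Θ.IsUniversal) ∧
    -- for any choice of the universal objects, they are the hom-objects of enriched categories
    (∀ (M : OperadWithMul k → OperadWithMul k → CoCoalg k)
      (Φ : ∀ O O', OperadMeasuring (M O O') O O'), (∀ O O', (Φ O O').IsUniversal) →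
      ∃ S : Enrichment M,
        S.InducedByOperads Φ ∧
        (∀ S' : Enrichment M, S'.InducedByOperads Φ → S' = S) ∧
        ∀ (Q : ∀ X Y : CompPair k, Comodule (M X.operad Y.operad))
          (Θ : ∀ X Y, ComoduleMeasuring (Φ X.operad Y.operad) (Q X Y) X.mod Y.mod),
          (∀ X Y, (Θ X Y).IsUniversal) →
          ∃! T : Enrichment (V := Comod k)
              fun X Y : CompPair k => ⟨M X.operad Y.operad, Q X Y⟩,
            T.InducedByPairs S Θ) := by
  refine ⟨OperadMeasuring.exists_isUniversal,
    fun C O O' Ψ L L' => ComoduleMeasuring.exists_isUniversal Ψ L L', fun M Φ hΦ => ?_⟩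
  obtain ⟨S, hS⟩ := exists_inducedByOperads hΦ
  refine ⟨S, hS, fun S' hS' => hS.eq hΦ hS', fun Q Θ hΘ => ?_⟩
  obtain ⟨T, hT⟩ := exists_inducedByPairs hS hΘ
  exact ⟨T, hT, fun T' hT' => hT.eq hΘ hT'⟩
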